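/- **Setting.** Let $n\in\{1,2\}$, $T>0$, and let $\Omega\subset\mathbb R^{n+1}$ be a bounded polyhedral domain. Let $\phi:\Omega\times[0,T]\to\mathbb R$ be smooth, $\Gamma(t)=\{x\in\Omega:\phi(x,t)=0\}$ and $U_r(t)=\{x\in\Omega:|\phi(x,t)|<r\}$. Assume that every $\Gamma(t)$ is (nonempty and) connected, and that there are $\delta_0>0$, $0<c_0\le c_1$, $c_2>0$ such that for all $t\in[0,T]$ one has $\overline{U_{\delta_0}(t)}\subset\Omega$ and, on $U_{\delta_0}(t)$, $c_0\le|\nabla\phi|\le c_1$ and $|D^2\phi|,|\phi_t|,|\phi_{tt}|\le c_2$. Let $\Phi:\Gamma(0)\times[0,T]\to\mathbb R^{n+1}$ be smooth, with $\Phi(\cdot,t)$ a diffeomorphism of $\Gamma(0)$ onto $\Gamma(t)$ for each $t\in[0,T]$, $\Phi(P,0)=P$ and $\partial_t\Phi(P,t)=\mathbf v(\Phi(P,t),t)$ for $t\in(0,T]$, where $\mathbf v$ is the given velocity field on the surfaces. Fix $0<\delta<\delta_0$. For $x\in U_\delta(t)$ let $\tilde p(x,t)=\Phi(P,t)$, where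 $P\in\Gamma(0)$ is the point for which the solution of $\gamma'(s)=\nabla\phi(\gamma(s),t)/|\nabla\phi(\gamma(s),t)|^2$, $|s|<\delta$, $\gamma(0)=\Phi(P,t)$, satisfies $\gamma(\phi(x,t))=x$. Put $z^e(x,t)=z(\tilde p(x,t),t)$ on $U_\delta(t)$, and $z^e=0$ outside $U_\delta(t)$. With $\nu=\nabla\phi/|\nabla\phi|$, $V=-\phi_t/|\nabla\phi|$ and $\mathbf v_\tau=(I-\nu\otimes\nu)\mathbf v$ on $\Gamma(t)$, extend $\mathbf v$ to $U_\delta(t)$ by $V\nu+(I-\nu\otimes\nu)\mathbf v_\tau^e$. Let $g(r)=\cos^2 r$ for $|r|\le\pi/2$ and $g(r)=0$ otherwise; for $0<\epsilon<\delta/\pi$ let $\rho=g(\phi/\epsilon)$ and $\tilde\rho=g(\phi/(2\epsilon))$ on $\Omega$, and $0$ outside $\Omega$. Let $\mathcal T_h$ be a conforming triangulation of $\overline\Omega$ into closed simplices with vertex set $\mathcal N_h$ and mesh size $h=\max_{K\in\mathcal T_h}h_K$, $h_K=\operatorname{diam}K$; it is called $\sigma$-regular if every $K\in\mathcal T_h$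 has inradius at least $\sigma h_K$. For a partition $0=t_0<\dots<t_M=T$ let $\tau_m=t_m-t_{m-1}$, $\tau=\max_m\tau_m$, and write $w^m=w(\cdot,t_m)$. Let $\mathcal T_h^m$ be the set of simplices with a vertex at which $\tilde\rho^m>0$, let $D_h^m$ be their union, and let $V_h^m$ be the space of continuous functions on $D_h^m$ that are affine on each simplex of $\mathcal T_h^m$; elements of $V_h^m$ are extended by $0$ outside $D_h^m$. Let $I_h^m$ be the Lagrange interpolation operator into $V_h^m$. Let $\gamma>0$. The scheme reads: for $m=1,\dots,M$ find $u_h^m\in V_h^m$ such that for all $v_h\in V_h^m$ $$\int_\Omega u_h^mv_h\rho^m|\nabla\phi^m|-\int_\Omega u_h^{m-1}v_h\rho^{m-1}|\nabla\phi^{m-1}|+\tau_m\int_\Omega(\nabla u_h^m,\nabla v_h)\rho^m|\nabla\phi^m|$$ $$-\tau_m\int_\Omega u_h^m(\mathbf v^m,\nabla v_h)\rho^m|\nabla\phi^m|+\gamma\tau_m^2\int_\Omega I_h^m\tilde\rho^m(\nabla u_h^m,\nabla v_h)=\tau_m\int_\Omega f^{e,m}v_h\rho^m|\nabla\phi^m|,\qquad(\ast)$$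 where $u_h^0\in V_h^0$ is the $L^2(D_h^0)$-projection of $u_0^e(x)=u_0(\tilde p(x,0))$, i.e. $\int_{D_h^0}u_h^0v_h=\int_{D_h^0}u_0^ev_h$ for all $v_h\in V_h^0$. The data $u_0$, $f$ are such that $u_0^e$ is integrable over $U_\delta(0)$ and $f^{e,m}$ is integrable over $U_\delta(t_m)$ for $m=1,\dots,M$. **Lemma 5 (existence).** Let $h_0>0$ and $\sigma>0$. There is $h_1\in(0,h_0]$ such that for every $0<h\le h_1$ there is $\tau_0>0$ with the following property: for every $\sigma$-regular triangulation $\mathcal T_h$ of mesh size $h$, every $0<\epsilon<\delta/\pi$, every $\gamma>0$, every partition of $[0,T]$ with $\tau\le\tau_0$ and all data $f$, $u_0$ as above, for each $m=1,\dots,M$ and each given $u_h^{m-1}\in V_h^{m-1}$ the equation $(\ast)$ has a unique solution $u_h^m\in V_h^m$; consequently the whole scheme, with the initial condition above, has a unique solution $(u_h^0,\dots,u_h^M)$. -/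

import Mathlib

open MeasureTheory Set
open scoped ContDiff

/-- The ambient Euclidean space `ℝ^(n+1)`. -/
abbrev Amb (n : ℕ) := EuclideanSpace ℝ (Fin (n + 1))

/-- The zero level set `Γ(t)` in `Ω` of a time dependent function `φ`. -/
def zeroSet {n : ℕ} (Ω : Set (Amb n)) (φ : Amb n → ℝ → ℝ) (t : ℝ) : Set (Amb n) :=
  {x | x ∈ Ω ∧ φ x t = 0}

/-- The band `U_r(t) = {x ∈ Ω : |φ(x,t)| < r}`. -/
def levelBand {n : ℕ} (Ω : Set (Amb n)) (φ : Amb n → ℝ → ℝ) (r t : ℝ) : Set (Amb n) :=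
  {x | x ∈ Ω ∧ |φ x t| < r}

/-- The spatial gradient `∇φ(x,t)`. -/
noncomputable def gradAt {n : ℕ} (φ : Amb n → ℝ → ℝ) (x : Amb n) (t : ℝ) : Amb n :=
  gradient (fun y => φ y t) x

/-- A moving surface `Γ(t)`, `0 ≤ t ≤ T`, given as the zero level set of a smooth function on
`Ω × [0,T]` (with nondegenerate gradient near `Γ(t)`), transported by a smooth family of
diffeomorphisms `Φ(·,t) : Γ(0) → Γ(t)` with velocity `vel`. -/
structure MovingSurface (n : ℕ) where
  /-- the bulk domain -/
  Ω : Set (Amb n)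
  /-- the final time -/
  T : ℝ
  /-- the level set function -/
  φ : Amb n → ℝ → ℝ
  /-- the flow map -/
  Φ : Amb n → ℝ → Amb n
  /-- the velocity field, prescribed on `Γ(t)` -/
  vel : Amb n → ℝ → Amb n
  /-- half-width, in level set values, of the band on which the derivative bounds hold -/
  δ₀ : ℝ
  c₀ : ℝ
  c₁ : ℝ
  c₂ : ℝ
  T_pos : 0 < T
  isOpen_Ω : IsOpen Ω
  isConnected_Ω : IsConnected Ω
  isBounded_Ω : Bornology.IsBounded Ω
  smooth_φ : ContDiffOn ℝ ∞ (fun q : Amb n × ℝ => φ q.1 q.2) (Ω ×ˢ Icc 0 T)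
  isConnected_Γ : ∀ t ∈ Icc 0 T, IsConnected (zeroSet Ω φ t)
  δ₀_pos : 0 < δ₀
  c₀_pos : 0 < c₀
  c₀_le : c₀ ≤ c₁
  c₂_pos : 0 < c₂
  closure_band : ∀ t ∈ Icc 0 T, closure (levelBand Ω φ δ₀ t) ⊆ Ω
  grad_lower : ∀ t ∈ Icc 0 T, ∀ x ∈ levelBand Ω φ δ₀ t, c₀ ≤ ‖gradAt φ x t‖
  grad_upper : ∀ t ∈ Icc 0 T, ∀ x ∈ levelBand Ω φ δ₀ t, ‖gradAt φ x t‖ ≤ c₁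
  hess_upper : ∀ t ∈ Icc 0 T, ∀ x ∈ levelBand Ω φ δ₀ t,
    ‖fderiv ℝ (fun y => gradAt φ y t) x‖ ≤ c₂
  dt_upper : ∀ t ∈ Icc 0 T, ∀ x ∈ levelBand Ω φ δ₀ t,
    |derivWithin (fun s => φ x s) (Icc 0 T) t| ≤ c₂
  dtt_upper : ∀ t ∈ Icc 0 T, ∀ x ∈ levelBand Ω φ δ₀ t,
    |iteratedDerivWithin 2 (fun s => φ x s) (Icc 0 T) t| ≤ c₂
  smooth_Φ : ContDiffOn ℝ ∞ (fun q : Amb n × ℝ => Φ q.1 q.2) (zeroSet Ω φ 0 ×ˢ Icc 0 T)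
  bijOn_Φ : ∀ t ∈ Icc 0 T, BijOn (fun P => Φ P t) (zeroSet Ω φ 0) (zeroSet Ω φ t)
  smooth_Φ_inv : ∀ t ∈ Icc 0 T,
    ContDiffOn ℝ ∞ (Function.invFunOn (fun P => Φ P t) (zeroSet Ω φ 0)) (zeroSet Ω φ t)
  flow_init : ∀ P ∈ zeroSet Ω φ 0, Φ P 0 = P
  flow : ∀ t ∈ Ioc 0 T, ∀ P ∈ zeroSet Ω φ 0,
    HasDerivWithinAt (fun s => Φ P s) (vel (Φ P t) t) (Icc 0 T) t

namespace MovingSurface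

variable {n : ℕ} (S : MovingSurface n)

/-- The surface `Γ(t)`. -/
def surf (t : ℝ) : Set (Amb n) := zeroSet S.Ω S.φ t

/-- The band `U_r(t)`. -/
def band (r t : ℝ) : Set (Amb n) := levelBand S.Ω S.φ r t

/-- The unit normal `ν = ∇φ / |∇φ|`, defined near `Γ(t)`. -/
noncomputable def normal (x : Amb n) (t : ℝ) : Amb n :=
  ‖gradAt S.φ x t‖⁻¹ • gradAt S.φ x t

/-- The normal velocity `V = -φ_t / |∇φ|`, defined near `Γ(t)`. -/
noncomputable def normalVel (x : Amb n) (t : ℝ) : ℝ :=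
  -derivWithin (fun s => S.φ x s) (Icc 0 S.T) t / ‖gradAt S.φ x t‖

/-- The projection `(I - ν ⊗ ν) w` at the point `(x,t)`. -/
noncomputable def tangProj (x : Amb n) (t : ℝ) (w : Amb n) : Amb n :=
  w - inner ℝ (S.normal x t) w • S.normal x t

/-- `γ` solves `γ' = ∇φ(γ,t) / |∇φ(γ,t)|²` on `(-δ,δ)` with `γ(0) = y`. -/
def IsNormalCurve (δ t : ℝ) (y : Amb n) (γ : ℝ → Amb n) : Prop :=
  γ 0 = y ∧ ∀ s ∈ Ioo (-δ) δ, γ s ∈ S.Ω ∧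
    HasDerivAt γ ((‖gradAt S.φ (γ s) t‖ ^ 2)⁻¹ • gradAt S.φ (γ s) t) s

/-- The label `p(x,t) ∈ Γ(0)`: the point `P` such that the normal curve through `Φ(P,t)` passes
through `x` at parameter value `φ(x,t)`. -/
noncomputable def label (δ : ℝ) (x : Amb n) (t : ℝ) : Amb n :=
  Classical.epsilon fun P => P ∈ S.surf 0 ∧
    ∃ γ : ℝ → Amb n, S.IsNormalCurve δ t (S.Φ P t) γ ∧ γ (S.φ x t) = x

/-- The projection `p̃(x,t) = Φ(p(x,t),t)` of `U_δ(t)` onto `Γ(t)`. -/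
noncomputable def proj (δ : ℝ) (x : Amb n) (t : ℝ) : Amb n :=
  S.Φ (S.label δ x t) t

open Classical in
/-- The extension `z^e(x,t) = z(p̃(x,t),t)` of a scalar function from `Γ(t)` to `U_δ(t)`
(with value `0` outside of `U_δ(t)`). -/
noncomputable def ext (δ : ℝ) (z : Amb n → ℝ → ℝ) (x : Amb n) (t : ℝ) : ℝ :=
  if x ∈ S.band δ t then z (S.proj δ x t) t else 0

/-- The extended velocity `V ν + (I - ν ⊗ ν) v_τ^e` on `U_δ(t)`, where `v_τ` is the tangential part
of the prescribed velocity on `Γ(t)`. -/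
noncomputable def velExt (δ : ℝ) (x : Amb n) (t : ℝ) : Amb n :=
  S.normalVel x t • S.normal x t +
    S.tangProj x t (S.tangProj (S.proj δ x t) t (S.vel (S.proj δ x t) t))

end MovingSurface

/-- The profile `g(r) = cos² r` for `|r| ≤ π/2`, and `0` otherwise. -/
noncomputable def profile (r : ℝ) : ℝ :=
  if |r| ≤ Real.pi / 2 then Real.cos r ^ 2 else 0

/-- The phase field `g(φ(x,t)/ε)` on `Ω`, extended by `0`. With parameter `ε` this is `ρ`, with
parameter `2ε` it is `ρ̃`. -/
noncomputable def MovingSurface.phase {n : ℕ} (S : MovingSurface n) (ε : ℝ) (x : Amb n) (t : ℝ) :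
    ℝ :=
  S.Ω.indicator (fun y => profile (S.φ y t / ε)) x

/-! ### Triangulations -/

/-- The closed simplex spanned by a finite set of points. -/
def simplex {n : ℕ} (s : Finset (Amb n)) : Set (Amb n) := convexHull ℝ (s : Set (Amb n))

/-- The top-dimensional simplices of a simplicial complex, through their vertex sets. -/
def cells {n : ℕ} (K : Geometry.SimplicialComplex ℝ (Amb n)) : Set (Finset (Amb n)) :=
  {s | s ∈ K.faces ∧ s.card = n + 2}

/-- `K` is a (conforming) triangulation of the polyhedral domain `Ω`: a finite simplicial complex
filling the closure of `Ω`, each of whose faces is a face of an `(n+1)`-dimensional simplex. -/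
structure IsTriangulation {n : ℕ} (Ω : Set (Amb n)) (K : Geometry.SimplicialComplex ℝ (Amb n)) :
    Prop where
  finite : K.faces.Finite
  pure : ∀ s ∈ K.faces, ∃ t ∈ cells K, s ⊆ t
  space_eq : K.space = closure Ω

/-- The mesh size: the largest diameter of a simplex. -/
noncomputable def meshSize {n : ℕ} (K : Geometry.SimplicialComplex ℝ (Amb n)) : ℝ :=
  sSup ((fun s => Metric.diam (simplex s)) '' cells K)

/-- The radius of the largest ball contained in a set. -/
noncomputable def inradius {n : ℕ} (A : Set (Amb n)) : ℝ :=
  sSup {r | 0 ≤ r ∧ ∃ c, Metric.closedBall c r ⊆ A}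

/-- Shape regularity with constant `σ`. -/
def IsShapeRegular {n : ℕ} (σ : ℝ) (K : Geometry.SimplicialComplex ℝ (Amb n)) : Prop :=
  ∀ s ∈ cells K, σ * Metric.diam (simplex s) ≤ inradius (simplex s)

/-! ### Discrete spaces and the scheme -/

namespace MovingSurface

variable {n : ℕ} (S : MovingSurface n) (K : Geometry.SimplicialComplex ℝ (Amb n))

/-- The active simplices at time `t`: those with a vertex at which `ρ̃(·,t) > 0`. -/
def activeCells (ε t : ℝ) : Set (Finset (Amb n)) :=
  {s | s ∈ cells K ∧ ∃ x ∈ s, 0 < S.phase (2 * ε) x t}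

/-- The discrete band: the union of the active simplices. -/
def discreteBand (ε t : ℝ) : Set (Amb n) :=
  ⋃ s ∈ S.activeCells K ε t, simplex s

/-- The finite element space on the discrete band: continuous functions that are affine on each
active simplex. They are represented by their extension by `0` to the whole space. -/
def feSpace (ε t : ℝ) : Set (Amb n → ℝ) :=
  {v | ContinuousOn v (S.discreteBand K ε t) ∧
    (∀ s ∈ S.activeCells K ε t, ∃ A : Amb n →ᵃ[ℝ] ℝ, EqOn v A (simplex s)) ∧
    ∀ x ∉ S.discreteBand K ε t, v x = 0}

/-- The Lagrange interpolant of `f`: the element of the finite element space that agrees with `f`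
at the vertices in the discrete band. -/
noncomputable def interp (ε t : ℝ) (f : Amb n → ℝ) : Amb n → ℝ :=
  Classical.epsilon fun w => w ∈ S.feSpace K ε t ∧
    ∀ x ∈ S.discreteBand K ε t ∩ K.vertices, w x = f x

/-- The weight `ρ |∇φ|`. -/
noncomputable def weight (ε : ℝ) (x : Amb n) (t : ℝ) : ℝ :=
  S.phase ε x t * ‖gradAt S.φ x t‖

/-- One step, from time `t'` to time `t`, of the fully discrete scheme: `u` is related to the
previous function `w` by the variational equation, tested with all elements of the finite element
space at time `t`. -/
def StepEq (δ ε γ : ℝ) (f : Amb n → ℝ → ℝ) (t' t : ℝ) (w u : Amb n → ℝ) : Prop :=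
  ∀ v ∈ S.feSpace K ε t,
    (∫ x in S.Ω, u x * v x * S.weight ε x t)
      - (∫ x in S.Ω, w x * v x * S.weight ε x t')
      + (t - t') * (∫ x in S.Ω, inner ℝ (gradient u x) (gradient v x) * S.weight ε x t)
      - (t - t') * (∫ x in S.Ω, u x * inner ℝ (S.velExt δ x t) (gradient v x) * S.weight ε x t)
      + γ * (t - t') ^ 2 * (∫ x in S.Ω, S.interp K ε t (fun y => S.phase (2 * ε) y t) x *
          inner ℝ (gradient u x) (gradient v x))
    = (t - t') * (∫ x in S.Ω, S.ext δ f x t * v x * S.weight ε x t)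

/-- `u` is the `L²` projection onto the initial finite element space of the extension of `u₀`. -/
def InitEq (δ ε : ℝ) (u₀ : Amb n → ℝ) (u : Amb n → ℝ) : Prop :=
  ∀ v ∈ S.feSpace K ε 0,
    (∫ x in S.discreteBand K ε 0, u x * v x)
      = ∫ x in S.discreteBand K ε 0, S.ext δ (fun y _ => u₀ y) x 0 * v x

end MovingSurface

/-- A partition `0 = t_0 < t_1 < ... < t_M = T` of `[0,T]`. -/
structure TimePartition (T : ℝ) where
  M : ℕ
  t : Fin (M + 1) → ℝ
  strictMono : StrictMono t
  first : t 0 = 0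
  last : t (Fin.last M) = T

/-- The maximal time step `τ`. -/
noncomputable def TimePartition.maxStep {T : ℝ} (P : TimePartition T) : ℝ :=
  ⨆ m : Fin P.M, (P.t m.succ - P.t m.castSucc)

/-- A discrete solution: a sequence `u^0, …, u^M` of finite element functions with the prescribed
initial function, each of which solves the scheme for the preceding one. -/
def MovingSurface.IsDiscreteSolution {n : ℕ} (S : MovingSurface n)
    (K : Geometry.SimplicialComplex ℝ (Amb n)) (δ ε γ : ℝ) (P : TimePartition S.T)
    (u₀ : Amb n → ℝ) (f : Amb n → ℝ → ℝ) (u : Fin (P.M + 1) → Amb n → ℝ) : Prop :=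
  (∀ m, u m ∈ S.feSpace K ε (P.t m)) ∧
  S.InitEq K δ ε u₀ (u 0) ∧
  ∀ m : Fin P.M, S.StepEq K δ ε γ f (P.t m.castSucc) (P.t m.succ) (u m.castSucc) (u m.succ)

/-! At a fixed time level (∗) is a square linear system: `feSpace` is finite dimensional, the terms
in u_h^m form a bilinear form B, and the rest is a linear functional. By `existsUnique_of_definite`
it is enough that B(u,u) = 0 forces u = 0; the whole scheme then follows by recursion
(`existsUnique_fin_recursion`).

Let C bound the extended velocity. Young's inequality absorbs the advection term into the diffusion
term and τ_m C²/4 times the mass term (`stepIntegrand_self_ge`). If τ_m C² < 4, then B(u,u) = 0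
gives u²ρ|∇φ| = 0 and (I_h ρ̃)|∇u|² = 0 almost everywhere. The second identity makes u constant on
each active cell; the first makes it vanish on active cells that meet Γ(t). It remains to link every
active cell to Γ(t) through active cells (`femSpace_eq_zero`).

The links come from `exists_cell_descent`. At a vertex x of the band, the direction −sgn(φ)∇φ/|∇φ|
points into some cell at x. Shape regularity provides an edge of this cell at x in a fixed cone
around that direction (`exists_edge_direction`), and for small h the first order decrease of |φ|
along the edge beats the Taylor remainder. So either |φ| is smaller at the other end, or the edge
crosses Γ(t). Hence no vertex with u ≠ 0 can minimize |φ|. Nothing here relates h to ε.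

The remaining analysis makes the integrals meaningful: the projection along normal curves is
continuous by Grönwall's inequality, and the velocity is bounded by compactness of Γ(0) × [0,T]. -/

open Filter Topology

namespace MovingSurface

variable {n : ℕ} (S : MovingSurface n)

/-! ### Bands around the level sets and a Taylor estimate -/

section LevelSets

variable {t : ℝ}

lemma contDiffOn_slice (ht : t ∈ Icc 0 S.T) : ContDiffOn ℝ ∞ (fun x => S.φ x t) S.Ω :=
  S.smooth_φ.comp (f := fun x => (x, t)) (by fun_prop) (fun _ hx => ⟨hx, ht⟩)

lemma continuousOn_slice (ht : t ∈ Icc 0 S.T) : ContinuousOn (fun x => S.φ x t) S.Ω :=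
  (S.contDiffOn_slice ht).continuousOn

lemma contDiffOn_gradAt (ht : t ∈ Icc 0 S.T) :
    ContDiffOn ℝ ∞ (fun x => gradAt S.φ x t) S.Ω := by
  have h := (S.contDiffOn_slice ht).fderiv_of_isOpen (m := ∞) S.isOpen_Ω (by simp)
  exact (InnerProductSpace.toDual ℝ (Amb n)).symm.contDiff.comp_contDiffOn h

lemma hasFDerivAt_slice (ht : t ∈ Icc 0 S.T) {x : Amb n} (hx : x ∈ S.Ω) :
    HasFDerivAt (fun y => S.φ y t) (innerSL ℝ (gradAt S.φ x t)) x := by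
  have hd : DifferentiableAt ℝ (fun y => S.φ y t) x :=
    ((S.contDiffOn_slice ht).contDiffAt (S.isOpen_Ω.mem_nhds hx)).differentiableAt (by simp)
  have h := hd.hasGradientAt
  exact h

lemma differentiableAt_gradAt (ht : t ∈ Icc 0 S.T) {x : Amb n} (hx : x ∈ S.Ω) :
    DifferentiableAt ℝ (fun y => gradAt S.φ y t) x :=
  ((S.contDiffOn_gradAt ht).contDiffAt (S.isOpen_Ω.mem_nhds hx)).differentiableAt (by simp)

lemma band_subset (r t : ℝ) : S.band r t ⊆ S.Ω := fun _ hx => hx.1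

lemma band_mono {r r' : ℝ} (h : r ≤ r') (t : ℝ) : S.band r t ⊆ S.band r' t :=
  fun _ hx => ⟨hx.1, hx.2.trans_le h⟩

lemma isOpen_band (ht : t ∈ Icc 0 S.T) (r : ℝ) : IsOpen (S.band r t) := by
  have := ((S.continuousOn_slice ht).abs).isOpen_inter_preimage S.isOpen_Ω (isOpen_Iio (a := r))
  exact this

lemma closure_band_subset (ht : t ∈ Icc 0 S.T) : closure (S.band S.δ₀ t) ⊆ S.Ω :=
  S.closure_band t ht

lemma abs_le_of_mem_closure_band (ht : t ∈ Icc 0 S.T) {r : ℝ} (hr : r ≤ S.δ₀) {x : Amb n}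
    (hx : x ∈ closure (S.band r t)) : x ∈ S.Ω ∧ |S.φ x t| ≤ r := by
  have hxΩ : x ∈ S.Ω := S.closure_band_subset ht (closure_mono (S.band_mono hr t) hx)
  refine ⟨hxΩ, ?_⟩
  have hc : ContinuousAt (fun y => |S.φ y t|) x :=
    ((S.continuousOn_slice ht).continuousAt (S.isOpen_Ω.mem_nhds hxΩ)).abs
  have := mem_closure_image hc hx
  exact closure_minimal (s := (fun y => |S.φ y t|) '' S.band r t) (t := Iic r)
    (by rintro _ ⟨y, hy, rfl⟩; exact hy.2.le) isClosed_Iic this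

lemma gradAt_ne_zero (ht : t ∈ Icc 0 S.T) {x : Amb n} (hx : x ∈ S.band S.δ₀ t) :
    gradAt S.φ x t ≠ 0 := by
  have := S.grad_lower t ht x hx
  intro h
  rw [h, norm_zero] at this
  exact absurd this (not_le.2 S.c₀_pos)

lemma hasDerivAt_segment (ht : t ∈ Icc 0 S.T) {x v : Amb n} {s : ℝ} (hs : x + s • v ∈ S.Ω) :
    HasDerivAt (fun s : ℝ => S.φ (x + s • v) t) (inner ℝ (gradAt S.φ (x + s • v) t) v) s := by
  have h1 : HasDerivAt (fun s : ℝ => x + s • v) v s := by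
    simpa using ((hasDerivAt_id s).smul_const v).const_add x
  exact (S.hasFDerivAt_slice ht hs).comp_hasDerivAt s h1

/-- Points close to a band lie in the band `U_{δ₀}`. -/
lemma add_mem_band (ht : t ∈ Icc 0 S.T) {δ : ℝ} {x v : Amb n} (hx : x ∈ S.band δ t)
    (hv : δ + S.c₁ * ‖v‖ ≤ S.δ₀) : x + v ∈ S.band S.δ₀ t := by
  have hc₁ : 0 ≤ S.c₁ := S.c₀_pos.le.trans S.c₀_le
  have hδ : δ ≤ S.δ₀ := by nlinarith [mul_nonneg hc₁ (norm_nonneg v)]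
  by_contra hcon
  have hline : Continuous fun s : ℝ => x + s • v := by fun_prop
  -- The least element `s` of `C` is the first exit time of the segment from U_{δ₀}. Up to then the
  -- mean value theorem bounds the change of φ by c₁‖v‖, so |φ| < δ₀ still holds at `s`; an exit
  -- through ∂Ω is excluded because the closure of U_{δ₀} lies in Ω.
  set C : Set ℝ := Icc 0 1 ∩ (fun s : ℝ => x + s • v) ⁻¹' (S.band S.δ₀ t)ᶜ with hC
  have hCc : IsCompact C :=
    isCompact_Icc.inter_right ((S.isOpen_band ht S.δ₀).isClosed_compl.preimage hline)
  have hCne : C.Nonempty := ⟨1, by simp [hC, hcon]⟩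
  obtain ⟨s, hsC, hsmin⟩ := hCc.exists_isLeast hCne
  have hlt : ∀ r ∈ Ico 0 s, x + r • v ∈ S.band S.δ₀ t := by
    intro r hr
    by_contra h
    exact absurd (hsmin ⟨⟨hr.1, hr.2.le.trans hsC.1.2⟩, h⟩) (not_le.2 hr.2)
  have hs0 : 0 < s := by
    rcases hsC.1.1.eq_or_lt with h | h
    · exfalso
      apply hsC.2
      simpa [← h] using S.band_mono hδ t hx
    · exact h
  have hscl : x + s • v ∈ closure (S.band S.δ₀ t) := by
    have h1 : s ∈ closure (Ico 0 s) := by rw [closure_Ico hs0.ne]; exact right_mem_Icc.2 hs0.le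
    exact closure_mono (by rintro _ ⟨r, hr, rfl⟩; exact hlt r hr)
      (mem_closure_image (f := fun s : ℝ => x + s • v) hline.continuousAt h1)
  have hΩ : ∀ r ∈ Icc 0 s, x + r • v ∈ S.Ω := by
    intro r hr
    rcases hr.2.eq_or_lt with h | h
    · rw [h]; exact S.closure_band_subset ht hscl
    · exact (hlt r ⟨hr.1, h⟩).1
  obtain ⟨r, hr, hreq⟩ := exists_hasDerivAt_eq_slope (fun s : ℝ => S.φ (x + s • v) t)
    (fun s => inner ℝ (gradAt S.φ (x + s • v) t) v) hs0
    (fun r hr => (S.hasDerivAt_segment ht (hΩ r hr)).continuousAt.continuousWithinAt)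
    (fun r hr => S.hasDerivAt_segment ht (hΩ r ⟨hr.1.le, hr.2.le⟩))
  apply hsC.2
  refine ⟨hΩ s (right_mem_Icc.2 hs0.le), ?_⟩
  have h1 : |(inner ℝ (gradAt S.φ (x + r • v) t) v : ℝ)| ≤ S.c₁ * ‖v‖ :=
    (abs_real_inner_le_norm _ _).trans
      (mul_le_mul_of_nonneg_right (S.grad_upper t ht _ (hlt r ⟨hr.1.le, hr.2⟩)) (norm_nonneg v))
  have h2 : S.φ (x + s • v) t = S.φ x t + s * inner ℝ (gradAt S.φ (x + r • v) t) v := by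
    have : s ≠ 0 := hs0.ne'
    simp only [zero_smul, add_zero, sub_zero] at hreq
    rw [hreq]; field_simp; ring
  have h3 : |s * (inner ℝ (gradAt S.φ (x + r • v) t) v : ℝ)| ≤ S.c₁ * ‖v‖ := by
    rw [abs_mul, abs_of_pos hs0]
    nlinarith [hsC.1.2, abs_nonneg (inner ℝ (gradAt S.φ (x + r • v) t) v : ℝ)]
  calc |S.φ (x + s • v) t| ≤ |S.φ x t| + |s * (inner ℝ (gradAt S.φ (x + r • v) t) v : ℝ)| := by
        rw [h2]; exact abs_add_le _ _
    _ < S.δ₀ := by have := hx.2; linarith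

lemma ball_subset_band (ht : t ∈ Icc 0 S.T) {δ r : ℝ} {x : Amb n} (hx : x ∈ S.band δ t)
    (hr : δ + S.c₁ * r ≤ S.δ₀) : Metric.closedBall x r ⊆ S.band S.δ₀ t := by
  intro y hy
  have hc₁ : 0 ≤ S.c₁ := S.c₀_pos.le.trans S.c₀_le
  have : ‖y - x‖ ≤ r := by simpa [dist_eq_norm] using hy
  have := S.add_mem_band ht (v := y - x) hx (by nlinarith)
  simpa using this

/-- First order Taylor estimate for the level set function near a band. -/
lemma taylor_le (ht : t ∈ Icc 0 S.T) {δ r : ℝ} {x z : Amb n} (hx : x ∈ S.band δ t)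
    (hr : δ + S.c₁ * r ≤ S.δ₀) (hz : ‖z - x‖ ≤ r) :
    |S.φ z t - S.φ x t - inner ℝ (gradAt S.φ x t) (z - x)| ≤ S.c₂ * ‖z - x‖ ^ 2 := by
  set B := Metric.closedBall x ‖z - x‖ with hB
  have hzB : z ∈ B := by simp [hB, dist_eq_norm]
  have hxB : x ∈ B := by simp [hB]
  have hconv : Convex ℝ B := convex_closedBall _ _
  have hBb : B ⊆ S.band S.δ₀ t :=
    (Metric.closedBall_subset_closedBall hz).trans (S.ball_subset_band ht hx hr)
  have hgrad : ∀ y ∈ B, ‖gradAt S.φ y t - gradAt S.φ x t‖ ≤ S.c₂ * ‖z - x‖ := by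
    intro y hy
    have h1 := hconv.norm_image_sub_le_of_norm_fderiv_le (𝕜 := ℝ)
      (f := fun y => gradAt S.φ y t) (C := S.c₂)
      (fun w hw => S.differentiableAt_gradAt ht (hBb hw).1)
      (fun w hw => S.hess_upper t ht w (hBb hw)) hxB hy
    refine h1.trans (mul_le_mul_of_nonneg_left ?_ S.c₂_pos.le)
    simpa [hB, dist_eq_norm] using hy
  -- A second mean value inequality, for φ minus its linear part at x, replaces Taylor's formula;
  -- the constant is c₂ instead of c₂/2.
  have h2 := hconv.norm_image_sub_le_of_norm_hasFDerivWithin_le (𝕜 := ℝ)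
    (f := fun y => S.φ y t - inner ℝ (gradAt S.φ x t) y) (C := S.c₂ * ‖z - x‖)
    (f' := fun y => innerSL ℝ (gradAt S.φ y t) - innerSL ℝ (gradAt S.φ x t))
    (fun w hw => ((S.hasFDerivAt_slice ht (hBb hw).1).sub
      (innerSL ℝ (gradAt S.φ x t)).hasFDerivAt).hasFDerivWithinAt)
    (fun w hw => by
      rw [← map_sub, innerSL_apply_norm]; exact hgrad w hw) hxB hzB
  rw [Real.norm_eq_abs] at h2
  calc _ = |S.φ z t - inner ℝ (gradAt S.φ x t) z - (S.φ x t - inner ℝ (gradAt S.φ x t) x)| := by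
        rw [inner_sub_right]; congr 1; ring
    _ ≤ _ := h2.trans_eq (by ring)

end LevelSets

end MovingSurface

/-- Two integral curves of a Lipschitz vector field stay close to each other, in both directions
of time. -/
lemma dist_le_of_hasDerivAt_lipschitz {E : Type*} [NormedAddCommGroup E] [NormedSpace ℝ E]
    {G : E → E} {C : NNReal} (hG : LipschitzWith C G) {I : Set ℝ} (hI : OrdConnected I)
    {γ₁ γ₂ : ℝ → E} (h₁ : ∀ s ∈ I, HasDerivAt γ₁ (G (γ₁ s)) s)
    (h₂ : ∀ s ∈ I, HasDerivAt γ₂ (G (γ₂ s)) s) {a b : ℝ} (ha : a ∈ I) (hb : b ∈ I) :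
    dist (γ₁ b) (γ₂ b) ≤ dist (γ₁ a) (γ₂ a) * Real.exp (C * |b - a|) := by
  rcases le_total a b with hab | hab
  · have hsub : ∀ s ∈ Icc a b, s ∈ I := fun s hs => hI.out ha hb hs
    have := dist_le_of_trajectories_ODE (v := fun _ => G) (a := a) (b := b)
      (fun _ => hG)
      (fun s hs => (h₁ s (hsub s hs)).continuousAt.continuousWithinAt)
      (fun s hs => (h₁ s (hsub s (Ico_subset_Icc_self hs))).hasDerivWithinAt)
      (fun s hs => (h₂ s (hsub s hs)).continuousAt.continuousWithinAt)
      (fun s hs => (h₂ s (hsub s (Ico_subset_Icc_self hs))).hasDerivWithinAt)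
      le_rfl b (right_mem_Icc.2 hab)
    rwa [abs_of_nonneg (sub_nonneg.2 hab)]
  -- Grönwall's inequality runs forward in time, so both curves are reversed and follow −G.
  · have hsub : ∀ s ∈ Icc (-a) (-b), -s ∈ I := fun s hs =>
      hI.out hb ha ⟨by linarith [hs.2], by linarith [hs.1]⟩
    have hneg : LipschitzWith C (fun x => -G x) := by
      intro x y; simpa [edist_neg_neg] using hG x y
    have hrev : ∀ γ : ℝ → E, (∀ s ∈ I, HasDerivAt γ (G (γ s)) s) → ∀ s ∈ Icc (-a) (-b),
        HasDerivAt (fun s => γ (-s)) (-G (γ (-s))) s := by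
      intro γ hγ s hs
      have := (hγ (-s) (hsub s hs)).scomp s (hasDerivAt_neg s)
      rwa [neg_one_smul] at this
    have := dist_le_of_trajectories_ODE (v := fun _ x => -G x) (a := -a) (b := -b)
      (fun _ => hneg)
      (fun s hs => (hrev γ₁ h₁ s hs).continuousAt.continuousWithinAt)
      (fun s hs => (hrev γ₁ h₁ s (Ico_subset_Icc_self hs)).hasDerivWithinAt)
      (fun s hs => (hrev γ₂ h₂ s hs).continuousAt.continuousWithinAt)
      (fun s hs => (hrev γ₂ h₂ s (Ico_subset_Icc_self hs)).hasDerivWithinAt)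
      le_rfl (-b) (right_mem_Icc.2 (by linarith))
    simp only [neg_neg] at this
    rw [abs_of_nonpos (sub_nonpos.2 hab)]
    convert this using 3
    ring_nf

/-- A bounded Lipschitz vector field has an integral curve on any bounded interval, with any
prescribed value. -/
lemma exists_integralCurve_of_lipschitz {E : Type*} [NormedAddCommGroup E] [NormedSpace ℝ E]
    [CompleteSpace E] {G : E → E} {C L : NNReal} (hG : LipschitzWith C G) (hL : ∀ x, ‖G x‖ ≤ L)
    {a b t₀ : ℝ} (ht₀ : t₀ ∈ Icc a b) (x : E) :
    ∃ γ : ℝ → E, γ t₀ = x ∧ ∀ s ∈ Icc a b, HasDerivWithinAt γ (G (γ s)) (Icc a b) s := by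
  -- Since G is bounded by L, a curve cannot leave the ball of radius L(b − a); one application
  -- covers the whole interval. The 0 is the radius of the set of initial values.
  have hpl : IsPicardLindelof (fun _ => G) (⟨t₀, ht₀⟩ : Icc a b) x
      (L * (b - a).toNNReal) 0 L C :=
    { lipschitzOnWith := fun _ _ => hG.lipschitzOnWith
      continuousOn := fun _ _ => continuousOn_const
      norm_le := fun _ _ y _ => hL y
      mul_max_le := by
        have : 0 ≤ b - a := by linarith [ht₀.1, ht₀.2]
        simp only [NNReal.coe_mul, Real.coe_toNNReal _ this, NNReal.coe_zero, sub_zero]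
        exact mul_le_mul_of_nonneg_left
          (max_le (by linarith [ht₀.1]) (by linarith [ht₀.2])) L.2 }
  exact hpl.exists_eq_forall_mem_Icc_hasDerivWithinAt₀

namespace MovingSurface

variable {n : ℕ} (S : MovingSurface n)

/-! ### Normal curves and the projection onto Γ(t) -/

section NormalCurves

variable {t : ℝ}

/-- The vector field `∇φ / |∇φ|²`. -/
noncomputable def normalField (x : Amb n) (t : ℝ) : Amb n :=
  (‖gradAt S.φ x t‖ ^ 2)⁻¹ • gradAt S.φ x t

lemma contDiffAt_normalField (ht : t ∈ Icc 0 S.T) {x : Amb n} (hx : x ∈ S.band S.δ₀ t) :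
    ContDiffAt ℝ ∞ (fun y => S.normalField y t) x := by
  have hg : ContDiffAt ℝ ∞ (fun y => gradAt S.φ y t) x :=
    (S.contDiffOn_gradAt ht).contDiffAt (S.isOpen_Ω.mem_nhds hx.1)
  exact ((hg.norm_sq ℝ).inv (by simpa using S.gradAt_ne_zero ht hx)).smul hg

/-- On `U_δ`, the field `∇φ / |∇φ|²` agrees with a globally Lipschitz bounded field. -/
lemma exists_lipschitz_normalField (ht : t ∈ Icc 0 S.T) {δ : ℝ} (hδ : δ < S.δ₀) :
    ∃ (G : Amb n → Amb n) (C L : NNReal), LipschitzWith C G ∧ (∀ x, ‖G x‖ ≤ L) ∧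
      ∀ x ∈ S.band δ t, G x = S.normalField x t := by
  -- The cutoff vanishes near the complement of U_{δ₀} and is 1 near the closure of U_δ, which is
  -- possible as δ < δ₀. The cut-off field is smooth with compact support, hence bounded and
  -- Lipschitz.
  obtain ⟨χ, h0, h1, -⟩ := exists_contMDiffMap_zero_one_nhds_of_isClosed
    (n := ⊤) (modelWithCornersSelf ℝ (Amb n)) (s := (S.band S.δ₀ t)ᶜ) (t := closure (S.band δ t))
    (S.isOpen_band ht S.δ₀).isClosed_compl isClosed_closure (by
      rw [Set.disjoint_left]
      intro x hx hx'
      obtain ⟨hΩ, hle⟩ := S.abs_le_of_mem_closure_band ht hδ.le hx'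
      exact hx ⟨hΩ, hle.trans_lt hδ⟩)
  have hχ : ContDiff ℝ ∞ χ := χ.contMDiff.contDiff
  set G : Amb n → Amb n := fun x => χ x • S.normalField x t with hG
  have hGs : ContDiff ℝ ∞ G := by
    rw [contDiff_iff_contDiffAt]
    intro x
    by_cases hx : x ∈ S.band S.δ₀ t
    · exact hχ.contDiffAt.smul (S.contDiffAt_normalField ht hx)
    · have : ∀ᶠ y in 𝓝 x, χ y = 0 := h0.filter_mono (nhds_le_nhdsSet hx)
      refine contDiffAt_const (c := (0 : Amb n)) |>.congr_of_eventuallyEq ?_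
      filter_upwards [this] with y hy
      simp [hG, hy]
  have hGc : HasCompactSupport G := by
    refine HasCompactSupport.intro (K := closure (S.band S.δ₀ t))
      ((S.isBounded_Ω.subset (S.band_subset _ _)).isCompact_closure) fun x hx => ?_
    have : χ x = 0 := h0.self_of_nhdsSet x (fun h => hx (subset_closure h))
    simp [hG, this]
  obtain ⟨C, hC⟩ := hGs.lipschitzWith_of_hasCompactSupport hGc (by simp)
  obtain ⟨L, hL⟩ := hGc.exists_bound_of_continuous hGs.continuous
  refine ⟨G, C, L.toNNReal, hC, fun x => (hL x).trans (Real.le_coe_toNNReal L), fun x hx => ?_⟩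
  have : χ x = 1 := h1.self_of_nhdsSet x (subset_closure hx)
  simp [hG, this]

/-- The factor |∇φ|⁻² makes φ grow at unit speed along normal curves, so that the parameter is the
value of φ. -/
lemma hasDerivAt_comp_of_normalField (ht : t ∈ Icc 0 S.T) {γ : ℝ → Amb n} {s : ℝ}
    (hs : γ s ∈ S.band S.δ₀ t) (hγ : HasDerivAt γ (S.normalField (γ s) t) s) :
    HasDerivAt (fun s => S.φ (γ s) t) 1 s := by
  have h := (S.hasFDerivAt_slice ht hs.1).comp_hasDerivAt s hγ
  have hne : ‖gradAt S.φ (γ s) t‖ ≠ 0 := norm_ne_zero_iff.2 (S.gradAt_ne_zero ht hs)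
  have h1 : innerSL ℝ (gradAt S.φ (γ s) t) (S.normalField (γ s) t) = 1 := by
    rw [innerSL_apply_apply, normalField, inner_smul_right, real_inner_self_eq_norm_sq]
    field_simp
  rwa [h1] at h

/-- Along a curve that is an integral curve of the normal field as long as it stays in `U_δ`,
the level set function equals the parameter. -/
lemma slice_eq_param (ht : t ∈ Icc 0 S.T) {δ : ℝ} (hδ : δ ≤ S.δ₀) {γ : ℝ → Amb n}
    (hc : ContinuousOn γ (Ioo (-δ) δ))
    (hγ : ∀ s ∈ Ioo (-δ) δ, γ s ∈ S.band δ t → HasDerivAt γ (S.normalField (γ s) t) s)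
    {s₀ : ℝ} (hs₀ : s₀ ∈ Ioo (-δ) δ) (hΩ : γ s₀ ∈ S.Ω) (hφ : S.φ (γ s₀) t = s₀) :
    ∀ s ∈ Ioo (-δ) δ, γ s ∈ S.band δ t ∧ S.φ (γ s) t = s := by
  -- Connectedness argument: `J` is open because φ(γ(q)) − q has zero derivative, and relatively
  -- closed because limits of points of the band stay in Ω.
  set J : Set ℝ := {s | s ∈ Ioo (-δ) δ ∧ γ s ∈ S.band δ t ∧ S.φ (γ s) t = s} with hJ
  have hJo : IsOpen J := by
    rw [Metric.isOpen_iff]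
    rintro s ⟨hs, hsb, hsφ⟩
    have h1 : ∀ᶠ r in 𝓝 s, r ∈ Ioo (-δ) δ ∧ γ r ∈ S.band δ t :=
      (isOpen_Ioo.eventually_mem hs).and <|
        (hc.continuousAt (isOpen_Ioo.mem_nhds hs)).eventually_mem
          ((S.isOpen_band ht δ).mem_nhds hsb)
    obtain ⟨η, hη, hball⟩ := Metric.eventually_nhds_iff_ball.1 h1
    refine ⟨η, hη, fun r hr => ⟨(hball r hr).1, (hball r hr).2, ?_⟩⟩
    have hd : ∀ q ∈ Metric.ball s η, HasDerivAt (fun q => S.φ (γ q) t - q) 0 q := by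
      intro q hq
      have := (S.hasDerivAt_comp_of_normalField ht (S.band_mono hδ t (hball q hq).2)
        (hγ q (hball q hq).1 (hball q hq).2)).sub (hasDerivAt_id q)
      rwa [sub_self] at this
    have := (convex_ball s η).norm_image_sub_le_of_norm_hasDerivWithin_le
      (f := fun q => S.φ (γ q) t - q) (f' := fun _ => (0 : ℝ)) (C := 0)
      (fun q hq => (hd q hq).hasDerivWithinAt) (by simp) (Metric.mem_ball_self hη) hr
    simp only [zero_mul, norm_le_zero_iff, hsφ, sub_self, sub_zero] at this
    linarith
  have hsub : Ioo (-δ) δ ⊆ J := by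
    refine isPreconnected_Ioo.subset_of_closure_inter_subset hJo ⟨s₀, hs₀, hs₀, ?_, hφ⟩ ?_
    · exact ⟨hΩ, by simp only [hφ]; exact abs_lt.2 hs₀⟩
    · rintro s ⟨hsJ, hs⟩
      have hcs : ContinuousAt γ s := hc.continuousAt (isOpen_Ioo.mem_nhds hs)
      have hcl : γ s ∈ closure (S.band δ t) :=
        closure_mono (by rintro _ ⟨r, hr, rfl⟩; exact hr.2.1)
          (mem_closure_image hcs hsJ)
      obtain ⟨hsΩ, -⟩ := S.abs_le_of_mem_closure_band ht hδ hcl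
      have hcφ : ContinuousAt (fun r => S.φ (γ r) t - r) s :=
        (((S.continuousOn_slice ht).continuousAt (S.isOpen_Ω.mem_nhds hsΩ)).comp
          (f := γ) hcs).sub continuousAt_id
      have : S.φ (γ s) t - s = 0 := by
        have hz := mem_closure_image hcφ hsJ
        have := closure_minimal (t := {(0 : ℝ)})
          (by rintro _ ⟨r, hr, rfl⟩; simp [hr.2.2]) isClosed_singleton hz
        simpa using this
      have hφs : S.φ (γ s) t = s := by linarith
      exact ⟨hs, ⟨hsΩ, by simp only [hφs]; exact abs_lt.2 hs⟩, hφs⟩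
  exact fun s hs => (hsub hs).2

lemma IsNormalCurve.mem_band {S : MovingSurface n} (ht : t ∈ Icc 0 S.T) {δ : ℝ} (hδ0 : 0 < δ)
    (hδ : δ ≤ S.δ₀) {y : Amb n} (hy : y ∈ S.surf t) {γ : ℝ → Amb n}
    (hγ : S.IsNormalCurve δ t y γ) :
    ∀ s ∈ Ioo (-δ) δ, γ s ∈ S.band δ t ∧ S.φ (γ s) t = s := by
  have h0 : (0 : ℝ) ∈ Ioo (-δ) δ := ⟨by linarith, hδ0⟩
  refine S.slice_eq_param ht hδ (fun s hs => (hγ.2 s hs).2.continuousAt.continuousWithinAt)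
    (fun s hs _ => (hγ.2 s hs).2) h0 (hγ.2 0 h0).1 ?_
  rw [hγ.1]; exact hy.2

/-- Through every point of `U_δ(t)` there is a normal curve. -/
lemma exists_isNormalCurve (ht : t ∈ Icc 0 S.T) {δ : ℝ} (hδ : δ < S.δ₀) {x : Amb n}
    (hx : x ∈ S.band δ t) :
    ∃ y ∈ S.surf t, ∃ γ, S.IsNormalCurve δ t y γ ∧ γ (S.φ x t) = x := by
  obtain ⟨G, C, L, hGC, hGL, hG⟩ := S.exists_lipschitz_normalField ht hδ
  have hφx := abs_lt.1 hx.2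
  have hδ0 : 0 < δ := (abs_nonneg _).trans_lt hx.2
  obtain ⟨γ, hγx, hγ⟩ := exists_integralCurve_of_lipschitz hGC hGL
    (a := -δ) (b := δ) ⟨hφx.1.le, hφx.2.le⟩ x
  have hγ' : ∀ s ∈ Ioo (-δ) δ, HasDerivAt γ (G (γ s)) s := fun s hs =>
    (hγ s (Ioo_subset_Icc_self hs)).hasDerivAt (Icc_mem_nhds hs.1 hs.2)
  have key := S.slice_eq_param ht hδ.le
    (fun s hs => (hγ' s hs).continuousAt.continuousWithinAt)
    (fun s hs hb => by rw [← hG _ hb]; exact hγ' s hs) hφx (by rw [hγx]; exact hx.1)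
    (by rw [hγx])
  have h0 : (0 : ℝ) ∈ Ioo (-δ) δ := ⟨by linarith, hδ0⟩
  refine ⟨γ 0, ⟨(key 0 h0).1.1, (key 0 h0).2⟩, γ, ⟨rfl, fun s hs => ⟨(key s hs).1.1, ?_⟩⟩, hγx⟩
  have := hγ' s hs
  rwa [hG _ (key s hs).1] at this

lemma label_spec (ht : t ∈ Icc 0 S.T) {δ : ℝ} (hδ : δ < S.δ₀) {x : Amb n}
    (hx : x ∈ S.band δ t) : S.label δ x t ∈ S.surf 0 ∧
      ∃ γ : ℝ → Amb n, S.IsNormalCurve δ t (S.proj δ x t) γ ∧ γ (S.φ x t) = x := by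
  obtain ⟨y, hy, γ, hγ, hγx⟩ := S.exists_isNormalCurve ht hδ hx
  obtain ⟨P, hP, rfl⟩ := (S.bijOn_Φ t ht).surjOn hy
  exact Classical.epsilon_spec (p := fun P => P ∈ S.surf 0 ∧
    ∃ γ : ℝ → Amb n, S.IsNormalCurve δ t (S.Φ P t) γ ∧ γ (S.φ x t) = x) ⟨P, hP, γ, hγ, hγx⟩

lemma proj_mem_surf (ht : t ∈ Icc 0 S.T) {δ : ℝ} (hδ : δ < S.δ₀) {x : Amb n}
    (hx : x ∈ S.band δ t) : S.proj δ x t ∈ S.surf t :=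
  (S.bijOn_Φ t ht).mapsTo (S.label_spec ht hδ hx).1

/-- For z near x, compare the two normal curves at the parameter φ(z): one passes through z, the
other through a point close to x. Grönwall's inequality transports this distance to the parameter 0,
where the curves pass through the two projections. The argument works for whatever label `epsilon`
selects. -/
lemma continuousOn_proj (ht : t ∈ Icc 0 S.T) {δ : ℝ} (hδ : δ < S.δ₀) :
    ContinuousOn (fun x => S.proj δ x t) (S.band δ t) := by
  obtain ⟨G, C, L, hGC, hGL, hG⟩ := S.exists_lipschitz_normalField ht hδ
  intro x hx
  have hδ0 : 0 < δ := (abs_nonneg _).trans_lt hx.2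
  have h0 : (0 : ℝ) ∈ Ioo (-δ) δ := ⟨by linarith, hδ0⟩
  have hcurve : ∀ z ∈ S.band δ t, ∃ γ : ℝ → Amb n, γ 0 = S.proj δ z t ∧ γ (S.φ z t) = z ∧
      ∀ s ∈ Ioo (-δ) δ, HasDerivAt γ (G (γ s)) s := by
    intro z hz
    obtain ⟨-, γ, hγ, hγz⟩ := S.label_spec ht hδ hz
    refine ⟨γ, hγ.1, hγz, fun s hs => ?_⟩
    rw [hG _ (hγ.mem_band ht hδ0 hδ.le (S.proj_mem_surf ht hδ hz) s hs).1]
    exact (hγ.2 s hs).2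
  obtain ⟨γ, hγ0, hγx, hγ⟩ := hcurve x hx
  have hcφ : ContinuousAt (fun z => S.φ z t) x :=
    (S.continuousOn_slice ht).continuousAt (S.isOpen_Ω.mem_nhds hx.1)
  have hcγ : ContinuousAt (fun z => γ (S.φ z t)) x :=
    ContinuousAt.comp (f := fun z => S.φ z t) (g := γ) (hγ _ (abs_lt.1 hx.2)).continuousAt hcφ
  have hlim : Tendsto (fun z => dist z (γ (S.φ z t)) * Real.exp (C * |0 - S.φ z t|)) (𝓝 x)
      (𝓝 0) := by
    have h1 : ContinuousAt (fun z => dist z (γ (S.φ z t)) * Real.exp (C * |0 - S.φ z t|)) x :=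
      (continuousAt_id.dist hcγ).mul
        (Real.continuous_exp.continuousAt.comp
          (continuousAt_const.mul (continuousAt_const.sub hcφ).abs))
    have := h1.tendsto
    simpa [hγx] using this
  rw [ContinuousWithinAt, tendsto_iff_dist_tendsto_zero]
  refine squeeze_zero' (Eventually.of_forall fun _ => dist_nonneg) ?_
    (hlim.mono_left nhdsWithin_le_nhds)
  filter_upwards [self_mem_nhdsWithin] with z hz
  obtain ⟨η, hη0, hηz, hη⟩ := hcurve z hz
  have := dist_le_of_hasDerivAt_lipschitz hGC ordConnected_Ioo hη hγ (abs_lt.1 hz.2) h0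
  rwa [hη0, hγ0, hηz] at this

end NormalCurves

/-! ### Boundedness and continuity of the extended velocity -/

section Velocity

/-- Γ(t) cannot accumulate at ∂Ω, since the closure of the band around it lies in Ω. -/
lemma isCompact_surf {t : ℝ} (ht : t ∈ Icc 0 S.T) : IsCompact (S.surf t) := by
  refine Metric.isCompact_of_isClosed_isBounded (isClosed_of_closure_subset fun x hx => ?_)
    (S.isBounded_Ω.subset fun x hx => hx.1)
  have hsub : ∀ r, 0 < r → S.surf t ⊆ S.band r t := fun r hr y hy =>
    ⟨hy.1, by rw [hy.2, abs_zero]; exact hr⟩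
  have hb : ∀ r, 0 < r → r ≤ S.δ₀ → x ∈ S.Ω ∧ |S.φ x t| ≤ r := fun r hr hr' =>
    S.abs_le_of_mem_closure_band ht hr' (closure_mono (hsub r hr) hx)
  refine ⟨(hb S.δ₀ S.δ₀_pos le_rfl).1, ?_⟩
  rw [← abs_nonpos_iff]
  refine le_of_forall_pos_le_add fun r hr => ?_
  have := (hb (min r S.δ₀) (lt_min hr S.δ₀_pos) (min_le_right _ _)).2
  simpa using this.trans (min_le_left _ _)

/-- Near each point of `Γ(0) × [0,T]`, the velocity of the flow map is given by a function that is
continuous at that point. -/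
lemma exists_flow_velocity {P : Amb n} {t : ℝ} (hP : P ∈ S.surf 0) (ht : t ∈ Icc 0 S.T) :
    ∃ g : Amb n × ℝ → Amb n,
      ContinuousWithinAt g (S.surf 0 ×ˢ Icc 0 S.T) (P, t) ∧
      ∀ᶠ q in 𝓝[S.surf 0 ×ˢ Icc 0 S.T] (P, t), q.2 ∈ Ioc 0 S.T →
        S.vel (S.Φ q.1 q.2) q.2 = g q := by
  set D : Set (Amb n × ℝ) := S.surf 0 ×ˢ Icc 0 S.T with hD
  have hq : (P, t) ∈ D := ⟨hP, ht⟩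
  -- Derivatives within `D` need not be unique in directions normal to Γ(0), so a local continuous
  -- choice `f'` is taken. Its value in the direction (0,1) is still determined by the time curves,
  -- and equals the velocity for positive times.
  have h1 : ContDiffWithinAt ℝ (0 + 1) (fun q : Amb n × ℝ => S.Φ q.1 q.2) D (P, t) :=
    (S.smooth_Φ (P, t) hq).of_le (by simp)
  rw [contDiffWithinAt_succ_iff_hasFDerivWithinAt (by simp)] at h1
  obtain ⟨u, hu, -, f', hf', hc⟩ := h1
  rw [insert_eq_of_mem hq] at hu
  refine ⟨fun q => f' q (0, 1), ?_, ?_⟩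
  · have hcw : ContinuousWithinAt f' D (P, t) := hc.continuousWithinAt.mono_of_mem_nhdsWithin hu
    exact hcw.clm_apply continuousWithinAt_const
  · filter_upwards [eventually_eventually_nhdsWithin.2 hu, hu, self_mem_nhdsWithin]
      with q hqu hqu' hqD hq2
    have hd : HasFDerivWithinAt (fun q : Amb n × ℝ => S.Φ q.1 q.2) (f' q) D q :=
      (hf' q hqu').mono_of_mem_nhdsWithin hqu
    have hcurve : HasDerivWithinAt (fun s : ℝ => (q.1, s)) ((0 : Amb n), (1 : ℝ)) (Icc 0 S.T) q.2 :=
      (hasDerivWithinAt_const _ _ _).prodMk (hasDerivWithinAt_id _ _)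
    have hcomp : HasDerivWithinAt (fun s => S.Φ q.1 s) (f' q (0, 1)) (Icc 0 S.T) q.2 :=
      HasFDerivWithinAt.comp_hasDerivWithinAt (f := fun s : ℝ => (q.1, s)) q.2 hd hcurve
        (fun s hs => ⟨hqD.1, hs⟩)
    exact ((uniqueDiffOn_Icc S.T_pos) q.2 hqD.2).eq_deriv _ (S.flow q.2 hq2 q.1 hqD.1) hcomp

/-- Compactness of Γ(0) × [0,T], including the time 0 at which `vel` is not prescribed, keeps the
bound uniform as t → 0. This lets τ₀ be chosen before the partition. -/
lemma exists_bound_vel : ∃ C : ℝ, 0 ≤ C ∧ ∀ t ∈ Ioc 0 S.T, ∀ y ∈ S.surf t, ‖S.vel y t‖ ≤ C := by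
  set D : Set (Amb n × ℝ) := S.surf 0 ×ˢ Icc 0 S.T with hD
  have h0 : (0 : ℝ) ∈ Icc 0 S.T := ⟨le_rfl, S.T_pos.le⟩
  have hcomp : IsCompact D := (S.isCompact_surf h0).prod isCompact_Icc
  have key : ∃ C : ℝ, ∀ q ∈ D, q.2 ∈ Ioc 0 S.T → ‖S.vel (S.Φ q.1 q.2) q.2‖ ≤ C := by
    refine hcomp.induction_on
      (p := fun s => ∃ C : ℝ, ∀ q ∈ s, q.2 ∈ Ioc 0 S.T → ‖S.vel (S.Φ q.1 q.2) q.2‖ ≤ C)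
      ⟨0, by simp⟩ (fun s s' hs h => ?_) (fun s s' h h' => ?_) (fun q hq => ?_)
    · obtain ⟨C, hC⟩ := h
      exact ⟨C, fun q hq => hC q (hs hq)⟩
    · obtain ⟨C, hC⟩ := h
      obtain ⟨C', hC'⟩ := h'
      refine ⟨max C C', fun q hq hq2 => ?_⟩
      rcases hq with hq | hq
      · exact (hC q hq hq2).trans (le_max_left _ _)
      · exact (hC' q hq hq2).trans (le_max_right _ _)
    · obtain ⟨g, hg, hev⟩ := S.exists_flow_velocity hq.1 hq.2
      have hb : ∀ᶠ r in 𝓝[D] q, ‖g r‖ < ‖g q‖ + 1 :=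
        hg.norm.eventually_lt continuousWithinAt_const (by simp)
      refine ⟨_, hb.and hev, ‖g q‖ + 1, fun r hr hr2 => ?_⟩
      rw [hr.2 hr2]
      exact hr.1.le
  obtain ⟨C, hC⟩ := key
  refine ⟨max C 0, le_max_right _ _, fun t ht y hy => ?_⟩
  obtain ⟨P, hP, rfl⟩ := (S.bijOn_Φ t (Ioc_subset_Icc_self ht)).surjOn hy
  exact (hC (P, t) ⟨hP, Ioc_subset_Icc_self ht⟩ ht).trans (le_max_left _ _)

lemma continuousOn_vel {t : ℝ} (ht : t ∈ Ioc 0 S.T) :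
    ContinuousOn (fun y => S.vel y t) (S.surf t) := by
  have ht' := Ioc_subset_Icc_self ht
  set ι : Amb n → Amb n := Function.invFunOn (fun P => S.Φ P t) (zeroSet S.Ω S.φ 0) with hι
  have hιmem : ∀ y ∈ S.surf t, ι y ∈ S.surf 0 := fun y hy =>
    Function.invFunOn_mem ((S.bijOn_Φ t ht').surjOn hy)
  have hιeq : ∀ y ∈ S.surf t, S.Φ (ι y) t = y := fun y hy =>
    Function.invFunOn_eq ((S.bijOn_Φ t ht').surjOn hy)
  intro y hy
  obtain ⟨g, hg, hev⟩ := S.exists_flow_velocity (hιmem y hy) ht'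
  have hcι : ContinuousWithinAt (fun y => (ι y, t)) (S.surf t) y :=
    ((S.smooth_Φ_inv t ht').continuousOn y hy).prodMk continuousWithinAt_const
  have hmaps : MapsTo (fun y => (ι y, t)) (S.surf t) (S.surf 0 ×ˢ Icc 0 S.T) :=
    fun z hz => ⟨hιmem z hz, ht'⟩
  have hcomp := ContinuousWithinAt.comp (f := fun y => (ι y, t)) hg hcι hmaps
  have hev' := (hcι.tendsto_nhdsWithin hmaps).eventually hev
  refine hcomp.congr_of_eventuallyEq_of_mem ?_ hy
  filter_upwards [hev', self_mem_nhdsWithin] with z hz hzs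
  have := hz ht
  simp only [hιeq z hzs] at this
  exact this

lemma continuousOn_normal {t : ℝ} (ht : t ∈ Icc 0 S.T) :
    ContinuousOn (fun x => S.normal x t) (S.band S.δ₀ t) := by
  have hg : ContinuousOn (fun x => gradAt S.φ x t) (S.band S.δ₀ t) :=
    (S.contDiffOn_gradAt ht).continuousOn.mono (S.band_subset _ _)
  exact (hg.norm.inv₀ fun x hx => norm_ne_zero_iff.2 (S.gradAt_ne_zero ht hx)).smul hg

lemma norm_normal_le (x : Amb n) (t : ℝ) : ‖S.normal x t‖ ≤ 1 := by
  rw [normal, norm_smul, norm_inv, norm_norm]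
  exact inv_mul_le_one

lemma continuousOn_normalVel {t : ℝ} (ht : t ∈ Icc 0 S.T) :
    ContinuousOn (fun x => S.normalVel x t) (S.band S.δ₀ t) := by
  have hg : ContinuousOn (fun x => gradAt S.φ x t) (S.band S.δ₀ t) :=
    (S.contDiffOn_gradAt ht).continuousOn.mono (S.band_subset _ _)
  have hU : UniqueDiffOn ℝ (S.Ω ×ˢ Icc 0 S.T) :=
    S.isOpen_Ω.uniqueDiffOn.prod (uniqueDiffOn_Icc S.T_pos)
  have hfd := S.smooth_φ.continuousOn_fderivWithin hU (by simp)
  have hdt : ContinuousOn (fun x => derivWithin (fun s => S.φ x s) (Icc 0 S.T) t) S.Ω := by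
    have h1 : ContinuousOn (fun x : Amb n => fderivWithin ℝ (fun q : Amb n × ℝ => S.φ q.1 q.2)
        (S.Ω ×ˢ Icc 0 S.T) (x, t) (0, 1)) S.Ω :=
      (hfd.comp (f := fun x : Amb n => (x, t)) (by fun_prop) (fun x hx => ⟨hx, ht⟩)).clm_apply
        continuousOn_const
    refine h1.congr fun x hx => ?_
    have hd : HasFDerivWithinAt (fun q : Amb n × ℝ => S.φ q.1 q.2) _ (S.Ω ×ˢ Icc 0 S.T) (x, t) :=
      ((S.smooth_φ (x, t) ⟨hx, ht⟩).differentiableWithinAt (by simp)).hasFDerivWithinAt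
    have hcurve : HasDerivWithinAt (fun s : ℝ => (x, s)) ((0 : Amb n), (1 : ℝ)) (Icc 0 S.T) t :=
      (hasDerivWithinAt_const _ _ _).prodMk (hasDerivWithinAt_id _ _)
    exact (HasFDerivWithinAt.comp_hasDerivWithinAt (f := fun s : ℝ => (x, s)) t hd hcurve
      (fun s hs => ⟨hx, hs⟩)).derivWithin ((uniqueDiffOn_Icc S.T_pos) t ht)
  exact ((hdt.mono (S.band_subset _ _)).neg).div hg.norm
    fun x hx => norm_ne_zero_iff.2 (S.gradAt_ne_zero ht hx)

lemma norm_tangProj_le (x : Amb n) (t : ℝ) (w : Amb n) : ‖S.tangProj x t w‖ ≤ 2 * ‖w‖ := by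
  have h1 : ‖(inner ℝ (S.normal x t) w : ℝ) • S.normal x t‖ ≤ ‖w‖ := by
    rw [norm_smul]
    have h2 := norm_inner_le_norm (𝕜 := ℝ) (S.normal x t) w
    have h3 := S.norm_normal_le x t
    have h4 := norm_nonneg (S.normal x t)
    have h5 := norm_nonneg w
    calc _ ≤ (‖S.normal x t‖ * ‖w‖) * ‖S.normal x t‖ := by gcongr
      _ ≤ (1 * ‖w‖) * 1 := by gcongr
      _ = ‖w‖ := by ring
  calc _ ≤ ‖w‖ + ‖(inner ℝ (S.normal x t) w : ℝ) • S.normal x t‖ := norm_sub_le _ _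
    _ ≤ _ := by linarith

/-- Supplies measurability: the integral of a non-integrable function is 0 by default, so without it
the advection term need not be bilinear. -/
lemma continuousOn_velExt {t δ : ℝ} (ht : t ∈ Ioc 0 S.T) (hδ : δ < S.δ₀) :
    ContinuousOn (fun x => S.velExt δ x t) (S.band δ t) := by
  have ht' := Ioc_subset_Icc_self ht
  have hsub : S.band δ t ⊆ S.band S.δ₀ t := S.band_mono hδ.le t
  have hsurf : S.surf t ⊆ S.band S.δ₀ t := fun y hy =>
    ⟨hy.1, by rw [hy.2, abs_zero]; exact S.δ₀_pos⟩
  have hν := (S.continuousOn_normal ht').mono hsub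
  have hV := (S.continuousOn_normalVel ht').mono hsub
  have hp := S.continuousOn_proj ht' hδ
  have hmaps : MapsTo (fun x => S.proj δ x t) (S.band δ t) (S.surf t) :=
    fun x hx => S.proj_mem_surf ht' hδ hx
  have hνp := ((S.continuousOn_normal ht').mono hsurf).comp hp hmaps
  have hvp := (S.continuousOn_vel ht).comp hp hmaps
  have htau : ContinuousOn
      (fun x => S.tangProj (S.proj δ x t) t (S.vel (S.proj δ x t) t)) (S.band δ t) :=
    hvp.sub ((hνp.inner (𝕜 := ℝ) hvp).smul hνp)
  exact (hV.smul hν).add (htau.sub ((hν.inner (𝕜 := ℝ) htau).smul hν))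

lemma exists_bound_velExt {δ : ℝ} (hδ : δ < S.δ₀) :
    ∃ C : ℝ, 0 ≤ C ∧ ∀ t ∈ Ioc 0 S.T, ∀ x ∈ S.band δ t, ‖S.velExt δ x t‖ ≤ C := by
  obtain ⟨C, hC0, hC⟩ := S.exists_bound_vel
  have hc₀ := S.c₀_pos
  have hc₂ := S.c₂_pos
  -- |V| ≤ c₂/c₀, and each of the two tangential projections is estimated by the crude factor 2.
  refine ⟨S.c₂ / S.c₀ + 4 * C, by positivity, fun t ht x hx => ?_⟩
  have ht' := Ioc_subset_Icc_self ht
  have hx' := S.band_mono hδ.le t hx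
  have h1 : ‖S.normalVel x t • S.normal x t‖ ≤ S.c₂ / S.c₀ := by
    rw [norm_smul]
    have : ‖S.normalVel x t‖ ≤ S.c₂ / S.c₀ := by
      rw [normalVel, norm_div, norm_neg, norm_norm]
      exact div_le_div₀ hc₂.le (S.dt_upper t ht' x hx') hc₀ (S.grad_lower t ht' x hx')
    calc _ ≤ S.c₂ / S.c₀ * 1 := by
          gcongr
          exact S.norm_normal_le x t
      _ = _ := mul_one _
  have h2 := S.norm_tangProj_le x t (S.tangProj (S.proj δ x t) t (S.vel (S.proj δ x t) t))
  have h3 := S.norm_tangProj_le (S.proj δ x t) t (S.vel (S.proj δ x t) t)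
  have h4 := hC t ht _ (S.proj_mem_surf ht' hδ hx)
  calc _ ≤ _ := norm_add_le _ _
    _ ≤ _ := by linarith

end Velocity

end MovingSurface

/-! ### Geometry of a single simplex -/

section Simplices

variable {n : ℕ} {K : Geometry.SimplicialComplex ℝ (Amb n)} {s : Finset (Amb n)}

lemma isCompact_simplex (s : Finset (Amb n)) : IsCompact (simplex s) :=
  s.finite_toSet.isCompact_convexHull (𝕜 := ℝ)

lemma isClosed_simplex (s : Finset (Amb n)) : IsClosed (simplex s) :=
  (isCompact_simplex s).isClosed

lemma convex_simplex (s : Finset (Amb n)) : Convex ℝ (simplex s) := convex_convexHull ℝ _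

lemma mem_simplex_of_mem {x : Amb n} (hx : x ∈ s) : x ∈ simplex s :=
  subset_convexHull ℝ _ (Finset.mem_coe.2 hx)

/-- The vertices of a cell form an affine basis. -/
lemma exists_affineBasis_of_mem_cells (hs : s ∈ cells K) :
    ∃ b : AffineBasis s ℝ (Amb n), ∀ i : s, b i = i := by
  have hind := K.indep hs.1
  have htop : affineSpan ℝ (range ((↑) : s → Amb n)) = ⊤ := by
    rw [hind.affineSpan_eq_top_iff_card_eq_finrank_add_one]
    simp [hs.2]
  exact ⟨⟨_, hind, htop⟩, fun _ => rfl⟩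

section Basis

variable {b : AffineBasis s ℝ (Amb n)} (hb : ∀ i : s, b i = i)
include hb

lemma simplex_eq_convexHull_range : simplex s = convexHull ℝ (range b) := by
  have : range b = (s : Set (Amb n)) := by
    ext x
    simp [hb]
  rw [this, simplex]

lemma mem_simplex_iff {x : Amb n} : x ∈ simplex s ↔ ∀ i, 0 ≤ b.coord i x := by
  rw [simplex_eq_convexHull_range hb, b.convexHull_eq_nonneg_coord]
  rfl

lemma mem_interior_simplex_iff {x : Amb n} :
    x ∈ interior (simplex s) ↔ ∀ i, 0 < b.coord i x := by
  rw [simplex_eq_convexHull_range hb, b.interior_convexHull]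
  rfl

lemma affineMap_eq_sum_coord (A : Amb n →ᵃ[ℝ] ℝ) (x : Amb n) :
    A x = ∑ i : s, b.coord i x * A i := by
  have h1 : x = Finset.univ.affineCombination ℝ b (fun i => b.coord i x) :=
    (b.affineCombination_coord_eq_self x).symm
  conv_lhs => rw [h1]
  rw [Finset.map_affineCombination _ _ _ (b.sum_coord_apply_eq_one x),
    Finset.affineCombination_eq_linear_combination _ _ _ (b.sum_coord_apply_eq_one x)]
  simp [hb]

lemma exists_affineMap_eq (f : Amb n → ℝ) : ∃ A : Amb n →ᵃ[ℝ] ℝ, ∀ x ∈ s, A x = f x := by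
  classical
  refine ⟨∑ i : s, f i • b.coord i, fun x hx => ?_⟩
  have hev : ∀ t : Finset s, (∑ i ∈ t, f i • b.coord i) x = ∑ i ∈ t, f i * b.coord i x := by
    intro t
    induction t using Finset.induction_on with
    | empty => simp
    | insert a t ha ih => rw [Finset.sum_insert ha, Finset.sum_insert ha, ← ih]; simp
  rw [hev]
  rw [Finset.sum_eq_single ⟨x, hx⟩]
  · have : b.coord ⟨x, hx⟩ x = 1 := by
      simpa only [hb] using b.coord_apply_eq ⟨x, hx⟩
    rw [this, mul_one]
  · intro j _ hj
    have : b.coord j x = 0 := by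
      simpa only [hb] using b.coord_apply_ne hj
    rw [this, mul_zero]
  · simp

end Basis

lemma interior_simplex_nonempty (hs : s ∈ cells K) : (interior (simplex s)).Nonempty := by
  obtain ⟨b, hb⟩ := exists_affineBasis_of_mem_cells hs
  rw [simplex_eq_convexHull_range hb]
  exact ⟨_, b.centroid_mem_interior_convexHull⟩

lemma simplex_subset_closure_interior (hs : s ∈ cells K) :
    simplex s ⊆ closure (interior (simplex s)) := by
  rw [(convex_simplex s).closure_interior_eq_closure_of_nonempty_interior
    (interior_simplex_nonempty hs)]
  exact subset_closure

lemma diam_simplex_pos (hs : s ∈ cells K) : 0 < Metric.diam (simplex s) := by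
  have hcard : 1 < s.card := by rw [hs.2]; omega
  obtain ⟨x, hx, y, hy, hxy⟩ := Finset.one_lt_card.1 hcard
  exact (dist_pos.2 hxy).trans_le (Metric.dist_le_diam_of_mem (isCompact_simplex s).isBounded
    (mem_simplex_of_mem hx) (mem_simplex_of_mem hy))

lemma norm_sub_le_diam {x z : Amb n} (hx : x ∈ simplex s) (hz : z ∈ simplex s) :
    ‖z - x‖ ≤ Metric.diam (simplex s) := by
  rw [← dist_eq_norm]
  exact Metric.dist_le_diam_of_mem (isCompact_simplex s).isBounded hz hx

lemma AffineMap.map_add_smul_eq {E : Type*} [AddCommGroup E] [Module ℝ E] (A : E →ᵃ[ℝ] ℝ)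
    (x d : E) (r : ℝ) : A (x + r • d) = r * A.linear d + A x := by
  have := A.map_vadd x (r • d)
  rwa [vadd_eq_add, vadd_eq_add, add_comm, map_smul, smul_eq_mul] at this

/-- The derivative of a barycentric coordinate is controlled by the radius of a ball contained in
the simplex. -/
lemma coord_linear_le {b : AffineBasis s ℝ (Amb n)} (hb : ∀ i : s, b i = i) {c : Amb n} {r : ℝ}
    (hr : 0 < r) (hball : Metric.closedBall c r ⊆ simplex s) {d : Amb n} (hd : ‖d‖ = 1) (i : s) :
    (b.coord i).linear d ≤ 1 / r := by
  have hc : c ∈ simplex s := hball (Metric.mem_closedBall_self hr.le)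
  have hcd : c + r • d ∈ simplex s := hball (by simp [norm_smul, hd, abs_of_pos hr])
  have h0 := (mem_simplex_iff hb).1 hc
  have h1 := (mem_simplex_iff hb).1 hcd
  have h2 : b.coord i (c + r • d) ≤ 1 := by
    rw [← b.sum_coord_apply_eq_one (c + r • d)]
    exact Finset.single_le_sum (fun j _ => h1 j) (Finset.mem_univ i)
  have h3 := (b.coord i).map_add_smul_eq c d r
  rw [le_div_iff₀ hr]
  linarith [h0 i]

/-- In a shape regular simplex, every direction pointing from a vertex into the simplex is
approximately the direction of some edge. -/
lemma exists_edge_direction (hs : s ∈ cells K) {σ : ℝ} (hσ : 0 < σ)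
    (hreg : σ * Metric.diam (simplex s) ≤ inradius (simplex s)) {x d : Amb n} (hx : x ∈ s)
    (hd : ‖d‖ = 1) {r : ℝ} (hr : 0 < r) (hxr : x + r • d ∈ simplex s) :
    ∃ z ∈ s, z ≠ x ∧ σ / (4 * (n + 2)) * ‖z - x‖ ≤ inner ℝ d (z - x) := by
  obtain ⟨b, hb⟩ := exists_affineBasis_of_mem_cells hs
  set D := Metric.diam (simplex s) with hD
  have hDpos : 0 < D := diam_simplex_pos hs
  -- The inradius is a supremum, so half of the regularity bound is given up to obtain an actual
  -- ball; radius 0 makes the set nonempty.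
  obtain ⟨q, ⟨hq0, c, hball⟩, hq⟩ := exists_lt_of_lt_csSup (s := {r | 0 ≤ r ∧
      ∃ c, Metric.closedBall c r ⊆ simplex s}) (b := σ * D / 2)
    ⟨0, le_rfl, x, by simpa using mem_simplex_of_mem hx⟩
    (lt_of_lt_of_le (by nlinarith [mul_pos hσ hDpos]) hreg)
  have hqpos : 0 < q := lt_trans (by positivity) hq
  -- The vector y − x = r d is the sum of the edges at x weighted by the barycentric coordinates of
  -- y, each at most 2r/(σD). If every edge violated the claim, each of the n + 2 terms of ⟨d, y −
  -- x⟩ = r would be at most r/(2(n + 2)), giving r ≤ r/2.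
  by_contra! hcon
  set y := x + r • d with hy
  have hcoord : ∀ i : s, (i : Amb n) ≠ x → b.coord i y ≤ r * (2 / (σ * D)) := by
    intro i hi
    have h1 : b.coord i y = r * (b.coord i).linear d + b.coord i x :=
      (b.coord i).map_add_smul_eq x d r
    have h2 : b.coord i x = 0 := by
      have : b ⟨x, hx⟩ = x := hb ⟨x, hx⟩
      conv_lhs => rw [← this]
      exact b.coord_apply_ne (fun h => hi (by rw [h]))
    rw [h1, h2, add_zero]
    refine mul_le_mul_of_nonneg_left ((coord_linear_le hb hqpos hball hd i).trans ?_) hr.le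
    rw [div_le_div_iff₀ hqpos (by positivity)]
    linarith
  have hpos := (mem_simplex_iff hb).1 hxr
  have hsum : y - x = ∑ i : s, b.coord i y • ((i : Amb n) - x) := by
    simp only [smul_sub, Finset.sum_sub_distrib, ← Finset.sum_smul, b.sum_coord_apply_eq_one,
      one_smul]
    have h := b.linear_combination_coord_eq_self y
    simp only [hb] at h
    rw [h]
  have hinner : r = ∑ i : s, b.coord i y * inner ℝ d ((i : Amb n) - x) := by
    have h1 : inner ℝ d (y - x) = r := by
      simp [hy, inner_smul_right, hd]
    rw [← h1, hsum, inner_sum]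
    simp [inner_smul_right]
  have hle : ∀ i ∈ (Finset.univ : Finset s),
      b.coord i y * inner ℝ d ((i : Amb n) - x) ≤ r / (2 * (n + 2)) := by
    intro i _
    by_cases hi : (i : Amb n) = x
    · rw [hi]; simp; positivity
    · have h1 := (hcon i i.2 hi).le
      have h2 : ‖(i : Amb n) - x‖ ≤ D :=
        norm_sub_le_diam (mem_simplex_of_mem hx) (mem_simplex_of_mem i.2)
      calc b.coord i y * inner ℝ d ((i : Amb n) - x)
          ≤ b.coord i y * (σ / (4 * (n + 2)) * D) := by
            refine mul_le_mul_of_nonneg_left (h1.trans ?_) (hpos i)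
            gcongr
        _ ≤ r * (2 / (σ * D)) * (σ / (4 * (n + 2)) * D) := by
            gcongr
            exact hcoord i hi
        _ = r / (2 * (n + 2)) := by field_simp; norm_num
  have := Finset.sum_le_sum hle
  rw [← hinner] at this
  simp only [Finset.sum_const, Finset.card_univ, Fintype.card_coe, hs.2, nsmul_eq_mul] at this
  push_cast at this
  have h2 : ((n : ℝ) + 2) * (r / (2 * (n + 2))) = r / 2 := by field_simp
  linarith

end Simplices

/-! ### Conforming triangulations -/

section Complex

variable {n : ℕ} {Ω : Set (Amb n)} {K : Geometry.SimplicialComplex ℝ (Amb n)}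

lemma cells_subset_faces : cells K ⊆ K.faces := fun _ hs => hs.1

lemma IsTriangulation.finite_cells (hK : IsTriangulation Ω K) : (cells K).Finite :=
  hK.finite.subset cells_subset_faces

lemma IsTriangulation.simplex_subset (hK : IsTriangulation Ω K) {s : Finset (Amb n)}
    (hs : s ∈ cells K) : simplex s ⊆ closure Ω := by
  rw [← hK.space_eq]
  exact Geometry.SimplicialComplex.convexHull_subset_space hs.1

lemma IsTriangulation.exists_mem_simplex (hK : IsTriangulation Ω K) {x : Amb n} (hx : x ∈ Ω) :
    ∃ s ∈ cells K, x ∈ simplex s := by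
  have hx' : x ∈ K.space := by rw [hK.space_eq]; exact subset_closure hx
  obtain ⟨s, hs, hxs⟩ := Geometry.SimplicialComplex.mem_space_iff.1 hx'
  obtain ⟨t, ht, hst⟩ := hK.pure s hs
  exact ⟨t, ht, convexHull_mono (by exact_mod_cast hst) hxs⟩

lemma IsTriangulation.diam_le_meshSize (hK : IsTriangulation Ω K) {s : Finset (Amb n)}
    (hs : s ∈ cells K) : Metric.diam (simplex s) ≤ meshSize K :=
  le_csSup (hK.finite_cells.image _).bddAbove ⟨s, hs, rfl⟩

lemma mem_vertices_of_mem_cell {s : Finset (Amb n)} (hs : s ∈ cells K) {x : Amb n}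
    (hx : x ∈ s) : x ∈ K.vertices :=
  K.down_closed hs.1 (by simpa using hx) (by simp)

/-- Conformity: {x} and s meet in the hull of their common vertices, so there is a common vertex. -/
lemma mem_of_mem_vertices_of_mem_simplex {s : Finset (Amb n)} (hs : s ∈ cells K) {x : Amb n}
    (hx : x ∈ K.vertices) (hxs : x ∈ simplex s) : x ∈ s := by
  have h := K.inter_subset_convexHull (s := {x}) (t := s) hx hs.1 ⟨by simp, hxs⟩
  have hne : (({x} : Finset (Amb n)) ∩ s : Set (Amb n)).Nonempty :=
    convexHull_nonempty_iff.1 ⟨x, h⟩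
  obtain ⟨y, hy, hys⟩ := hne
  simp only [Finset.coe_singleton, mem_singleton_iff] at hy
  exact hy ▸ hys

/-- From a vertex in `Ω`, one can move a bit in any given direction within some cell that has this
vertex. -/
lemma IsTriangulation.exists_cell_direction (hK : IsTriangulation Ω K) (hΩ : IsOpen Ω)
    {x : Amb n} (hx : x ∈ K.vertices) (hxΩ : x ∈ Ω) (d : Amb n) :
    ∃ s ∈ cells K, x ∈ s ∧ ∃ r : ℝ, 0 < r ∧ x + r • d ∈ simplex s := by
  -- Finitely many closed cells miss x, so every point of Ω close enough to x lies in a cell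
  -- containing x.
  set F : Set (Amb n) := ⋃ s ∈ {s | s ∈ cells K ∧ x ∉ simplex s}, simplex s with hF
  have hFc : IsClosed F :=
    (hK.finite_cells.subset fun s hs => hs.1).isClosed_biUnion fun s _ => isClosed_simplex s
  have hxF : x ∉ F := by
    simp only [hF, mem_iUnion, not_exists]
    exact fun s hs => hs.2
  have hlim : Tendsto (fun r : ℝ => x + r • d) (𝓝[>] 0) (𝓝 x) := by
    have : ContinuousAt (fun r : ℝ => x + r • d) 0 := by fun_prop
    have h := this.tendsto
    simp only [zero_smul, add_zero] at h
    exact h.mono_left nhdsWithin_le_nhds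
  have hev : ∀ᶠ y in 𝓝 x, y ∈ Ω ∧ y ∉ F :=
    (hΩ.eventually_mem hxΩ).and (hFc.isOpen_compl.eventually_mem hxF)
  obtain ⟨r, ⟨hrΩ, hrF⟩, hr⟩ := ((hlim.eventually hev).and self_mem_nhdsWithin).exists
  obtain ⟨s, hs, hrs⟩ := hK.exists_mem_simplex hrΩ
  have hxs : x ∈ simplex s := by
    by_contra h
    exact hrF (mem_biUnion (x := s) ⟨hs, h⟩ hrs)
  exact ⟨s, hs, mem_of_mem_vertices_of_mem_simplex hs hx hxs, r, hr, hrs⟩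

end Complex

/-! ### Piecewise affine functions on a set of cells -/

section FiniteElements

variable {n : ℕ} {K : Geometry.SimplicialComplex ℝ (Amb n)} {C : Set (Finset (Amb n))}

/-- The union of a set of simplices. -/
def region (C : Set (Finset (Amb n))) : Set (Amb n) := ⋃ s ∈ C, simplex s

/-- Continuous functions on the union of a set of simplices, affine on each of them, extended by
zero. -/
def femSpace (C : Set (Finset (Amb n))) : Submodule ℝ (Amb n → ℝ) where
  carrier := {v | ContinuousOn v (region C) ∧
    (∀ s ∈ C, ∃ A : Amb n →ᵃ[ℝ] ℝ, EqOn v A (simplex s)) ∧ ∀ x ∉ region C, v x = 0}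
  add_mem' := by
    rintro u v ⟨hu, hu', hu0⟩ ⟨hv, hv', hv0⟩
    refine ⟨hu.add hv, fun s hs => ?_, fun x hx => by simp [hu0 x hx, hv0 x hx]⟩
    obtain ⟨A, hA⟩ := hu' s hs
    obtain ⟨B, hB⟩ := hv' s hs
    exact ⟨A + B, fun x hx => by simp [hA hx, hB hx]⟩
  zero_mem' := ⟨continuousOn_const, fun s _ => ⟨0, fun x _ => by simp⟩, fun _ _ => rfl⟩
  smul_mem' := by
    rintro c u ⟨hu, hu', hu0⟩
    refine ⟨hu.const_smul c, fun s hs => ?_, fun x hx => by simp [hu0 x hx]⟩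
    obtain ⟨A, hA⟩ := hu' s hs
    exact ⟨c • A, fun x hx => by simp [hA hx]⟩

lemma simplex_subset_region {s : Finset (Amb n)} (hs : s ∈ C) : simplex s ⊆ region C :=
  subset_biUnion_of_mem (u := fun s => simplex s) hs

lemma mem_region {x : Amb n} : x ∈ region C ↔ ∃ s ∈ C, x ∈ simplex s := by
  simp [region]

lemma isCompact_region (hC : C.Finite) : IsCompact (region C) :=
  hC.isCompact_biUnion fun s _ => isCompact_simplex s

lemma AffineMap.eqOn_convexHull {A B : Amb n →ᵃ[ℝ] ℝ} {s : Set (Amb n)} (h : EqOn A B s) :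
    EqOn A B (convexHull ℝ s) := by
  have hconv : Convex ℝ {x | A x = B x} := by
    intro x hx y hy a b _ _ hab
    simp only [mem_ofPred_eq] at *
    rw [Convex.combo_affine_apply hab, Convex.combo_affine_apply hab, hx, hy]
  exact fun x hx => convexHull_min (fun y hy => h hy) hconv hx

/-- An affine function is given by its gradient and one value. -/
lemma exists_gradient_affineMap (A : Amb n →ᵃ[ℝ] ℝ) :
    ∃ g : Amb n, ∃ c : ℝ, ∀ x, A x = inner ℝ g x + c := by
  refine ⟨(InnerProductSpace.toDual ℝ (Amb n)).symm A.linear.toContinuousLinearMap, A 0,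
    fun x => ?_⟩
  rw [InnerProductSpace.toDual_symm_apply]
  have := A.map_add_smul_eq 0 x 1
  simpa using this

lemma hasGradientAt_of_eqOn_inner {u : Amb n → ℝ} {s : Set (Amb n)} {g : Amb n} {c : ℝ}
    (h : ∀ x ∈ s, u x = inner ℝ g x + c) {x : Amb n} (hx : x ∈ interior s) :
    HasGradientAt u g x := by
  have h1 : HasGradientAt (fun x => inner ℝ g x + c) g x :=
    (innerSL ℝ g).hasFDerivAt.add_const c
  refine h1.congr_of_eventuallyEq ?_
  filter_upwards [mem_interior_iff_mem_nhds.1 hx] with y hy using h y hy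

lemma femSpace.exists_gradient {u : Amb n → ℝ} (hu : u ∈ femSpace C) {s : Finset (Amb n)}
    (hs : s ∈ C) : ∃ g : Amb n, ∃ c : ℝ, ∀ x ∈ simplex s, u x = inner ℝ g x + c := by
  obtain ⟨A, hA⟩ := hu.2.1 s hs
  obtain ⟨g, c, hg⟩ := exists_gradient_affineMap A
  exact ⟨g, c, fun x hx => (hA hx).trans (hg x)⟩

lemma femSpace.ext_vertices {u v : Amb n → ℝ} (hu : u ∈ femSpace C) (hv : v ∈ femSpace C)
    (h : ∀ s ∈ C, ∀ x ∈ s, u x = v x) : u = v := by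
  funext x
  by_cases hx : x ∈ region C
  · obtain ⟨s, hs, hxs⟩ := mem_region.1 hx
    obtain ⟨A, hA⟩ := hu.2.1 s hs
    obtain ⟨B, hB⟩ := hv.2.1 s hs
    rw [hA hxs, hB hxs]
    refine AffineMap.eqOn_convexHull (s := (s : Set (Amb n))) (fun y hy => ?_) hxs
    rw [← hA (mem_simplex_of_mem hy), ← hB (mem_simplex_of_mem hy), h s hs y hy]
  · rw [hu.2.2 x hx, hv.2.2 x hx]

lemma femSpace.finiteDimensional (hC : C.Finite) : FiniteDimensional ℝ (femSpace C) := by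
  set N : Set (Amb n) := ⋃ s ∈ C, (s : Set (Amb n)) with hN
  have hNf : N.Finite := hC.biUnion fun s _ => s.finite_toSet
  have : Finite N := hNf
  let ev : femSpace C →ₗ[ℝ] (N → ℝ) :=
    { toFun := fun u x => u.1 x
      map_add' := fun _ _ => rfl
      map_smul' := fun _ _ => rfl }
  refine FiniteDimensional.of_injective ev fun u v huv => ?_
  refine Subtype.ext (femSpace.ext_vertices u.2 v.2 fun s hs x hx => ?_)
  exact congrFun huv ⟨x, mem_biUnion hs hx⟩

/-- Existence of the Lagrange interpolant. -/
lemma femSpace.exists_interpolant (hCK : C ⊆ cells K) (hC : C.Finite) (f : Amb n → ℝ) :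
    ∃ w ∈ femSpace C, ∀ s ∈ C, ∀ x ∈ s, w x = f x := by
  classical
  have hA : ∀ s : Finset (Amb n), ∃ A : Amb n →ᵃ[ℝ] ℝ, s ∈ C → ∀ x ∈ s, A x = f x := by
    intro s
    by_cases hs : s ∈ C
    · obtain ⟨b, hb⟩ := exists_affineBasis_of_mem_cells (hCK hs)
      obtain ⟨A, hA⟩ := exists_affineMap_eq hb f
      exact ⟨A, fun _ => hA⟩
    · exact ⟨0, fun h => absurd h hs⟩
  choose A hA using hA
  -- Two cells meet in the hull of their common vertices, where both affine pieces take the values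
  -- of `f`; hence they glue, and continuity follows from the finite closed cover.
  have hagree : ∀ s ∈ C, ∀ r ∈ C, ∀ x ∈ simplex s, x ∈ simplex r → A s x = A r x := by
    intro s hs r hr x hxs hxr
    have hx := K.inter_subset_convexHull (hCK hs).1 (hCK hr).1 ⟨hxs, hxr⟩
    refine AffineMap.eqOn_convexHull (fun y hy => ?_) hx
    rw [hA s hs y hy.1, hA r hr y hy.2]
  set w : Amb n → ℝ := fun x =>
    if h : ∃ s ∈ C, x ∈ simplex s then A h.choose x else 0 with hw
  have hws : ∀ s ∈ C, EqOn w (A s) (simplex s) := by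
    intro s hs x hx
    have h : ∃ s ∈ C, x ∈ simplex s := ⟨s, hs, hx⟩
    simp only [hw, dif_pos h]
    exact hagree _ h.choose_spec.1 s hs x h.choose_spec.2 hx
  refine ⟨w, ⟨?_, fun s hs => ⟨A s, hws s hs⟩, fun x hx => ?_⟩, fun s hs x hx => ?_⟩
  · have : Finite C := hC
    rw [region, biUnion_eq_iUnion]
    refine (locallyFinite_of_finite _).continuousOn_iUnion (fun s => isClosed_simplex s.1)
      fun s => ?_
    obtain ⟨g, c, hg⟩ := exists_gradient_affineMap (A s.1)
    have : Continuous (A s.1) := by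
      have : (A s.1 : Amb n → ℝ) = fun x => inner ℝ g x + c := funext hg
      rw [this]; fun_prop
    exact this.continuousOn.congr (hws s.1 s.2)
  · have h : ¬ ∃ s ∈ C, x ∈ simplex s := fun h => hx (mem_region.2 h)
    simp only [hw, dif_neg h]
  · rw [hws s hs (mem_simplex_of_mem hx), hA s hs x hx]

lemma femSpace.nonneg (hCK : C ⊆ cells K) {w : Amb n → ℝ} (hw : w ∈ femSpace C)
    (h : ∀ s ∈ C, ∀ x ∈ s, 0 ≤ w x) (x : Amb n) : 0 ≤ w x := by
  by_cases hx : x ∈ region C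
  · obtain ⟨s, hs, hxs⟩ := mem_region.1 hx
    obtain ⟨A, hA⟩ := hw.2.1 s hs
    obtain ⟨b, hb⟩ := exists_affineBasis_of_mem_cells (hCK hs)
    rw [hA hxs, affineMap_eq_sum_coord hb]
    refine Finset.sum_nonneg fun i _ => mul_nonneg ((mem_simplex_iff hb).1 hxs i) ?_
    rw [← hA (mem_simplex_of_mem i.2)]
    exact h s hs i i.2
  · rw [hw.2.2 x hx]

/-- All barycentric coordinates are positive in the interior, so one positive vertex value is
enough. This fits the definition of active cells by a single vertex with ρ̃ > 0. -/
lemma femSpace.pos_of_mem_interior (hCK : C ⊆ cells K) {w : Amb n → ℝ} (hw : w ∈ femSpace C)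
    {s : Finset (Amb n)} (hs : s ∈ C) (h : ∀ x ∈ s, 0 ≤ w x) (h' : ∃ x ∈ s, 0 < w x)
    {x : Amb n} (hx : x ∈ interior (simplex s)) : 0 < w x := by
  have hxs := interior_subset hx
  obtain ⟨A, hA⟩ := hw.2.1 s hs
  obtain ⟨b, hb⟩ := exists_affineBasis_of_mem_cells (hCK hs)
  rw [hA hxs, affineMap_eq_sum_coord hb]
  have hpos := (mem_interior_simplex_iff hb).1 hx
  obtain ⟨z, hz, hwz⟩ := h'
  refine Finset.sum_pos' (fun i _ => mul_nonneg (hpos i).le ?_)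
    ⟨⟨z, hz⟩, Finset.mem_univ _, mul_pos (hpos _) ?_⟩
  · rw [← hA (mem_simplex_of_mem i.2)]
    exact h i i.2
  · rwa [← hA (mem_simplex_of_mem hz)]

lemma femSpace.measurable (hC : C.Finite) {u : Amb n → ℝ} (hu : u ∈ femSpace C) :
    Measurable u := by
  classical
  have hm : MeasurableSet (region C) := (isCompact_region hC).measurableSet
  have h1 : u = (region C).piecewise u (fun _ => 0) := by
    funext x
    by_cases hx : x ∈ region C
    · simp [hx]
    · simp [hx, hu.2.2 x hx]
  rw [h1]
  exact hu.1.measurable_piecewise continuousOn_const hm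

lemma femSpace.exists_bound (hC : C.Finite) {u : Amb n → ℝ} (hu : u ∈ femSpace C) :
    ∃ M : ℝ, ∀ x, ‖u x‖ ≤ M := by
  obtain ⟨M, hM⟩ := (isCompact_region hC).exists_bound_of_continuousOn hu.1
  refine ⟨max M 0, fun x => ?_⟩
  by_cases hx : x ∈ region C
  · exact (hM x hx).trans (le_max_left _ _)
  · rw [hu.2.2 x hx, norm_zero]; exact le_max_right _ _

/-- Almost every point lies in the interior of a simplex or off the union of the simplices. -/
lemma ae_mem_interior_or_notMem (hC : C.Finite) :
    ∀ᵐ x : Amb n, (∃ s ∈ C, x ∈ interior (simplex s)) ∨ x ∉ region C := by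
  have h : ∀ᵐ x : Amb n, ∀ s ∈ C, x ∉ frontier (simplex s) := by
    rw [ae_ball_iff hC.countable]
    intro s _
    exact measure_eq_zero_iff_ae_notMem.1 ((convex_simplex s).addHaar_frontier volume)
  filter_upwards [h] with x hx
  by_cases hxr : x ∈ region C
  · left
    obtain ⟨s, hs, hxs⟩ := mem_region.1 hxr
    refine ⟨s, hs, ?_⟩
    by_contra hcon
    exact hx s hs ⟨subset_closure hxs, hcon⟩
  · exact Or.inr hxr

lemma femSpace.hasGradientAt_zero (hC : C.Finite) {u : Amb n → ℝ} (hu : u ∈ femSpace C)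
    {x : Amb n} (hx : x ∉ region C) : HasGradientAt u 0 x := by
  refine (hasGradientAt_const x 0).congr_of_eventuallyEq ?_
  filter_upwards [(isCompact_region hC).isClosed.isOpen_compl.mem_nhds hx] with y hy
    using hu.2.2 y hy

lemma femSpace.ae_differentiableAt (hC : C.Finite) {u : Amb n → ℝ} (hu : u ∈ femSpace C) :
    ∀ᵐ x : Amb n, DifferentiableAt ℝ u x := by
  filter_upwards [ae_mem_interior_or_notMem hC] with x hx
  rcases hx with ⟨s, hs, hxs⟩ | hx
  · obtain ⟨g, c, hg⟩ := femSpace.exists_gradient hu hs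
    exact (hasGradientAt_of_eqOn_inner hg hxs).differentiableAt
  · exact (femSpace.hasGradientAt_zero hC hu hx).differentiableAt

lemma femSpace.ae_norm_gradient_le (hC : C.Finite) {u : Amb n → ℝ} (hu : u ∈ femSpace C) :
    ∃ M : ℝ, ∀ᵐ x : Amb n, ‖gradient u x‖ ≤ M := by
  choose! g c hg using fun s (hs : s ∈ C) => femSpace.exists_gradient hu hs
  obtain ⟨M, hM⟩ := (hC.image fun s => ‖g s‖).bddAbove
  refine ⟨max M 0, ?_⟩
  filter_upwards [ae_mem_interior_or_notMem hC] with x hx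
  rcases hx with ⟨s, hs, hxs⟩ | hx
  · rw [(hasGradientAt_of_eqOn_inner (hg s hs) hxs).gradient]
    exact (hM ⟨s, hs, rfl⟩).trans (le_max_left _ _)
  · rw [(femSpace.hasGradientAt_zero hC hu hx).gradient, norm_zero]
    exact le_max_right _ _

lemma measurable_gradient (u : Amb n → ℝ) : Measurable (gradient u) :=
  (InnerProductSpace.toDual ℝ (Amb n)).symm.continuous.measurable.comp (measurable_fderiv ℝ u)

end FiniteElements

/-! ### Integrability and abstract variational problems -/

section EssBdd

variable {α : Type*} [MeasurableSpace α] {μ : Measure α}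

/-- Almost everywhere measurable and almost everywhere bounded functions. -/
def EssBdd {F : Type*} [NormedAddCommGroup F] (μ : Measure α) (f : α → F) : Prop :=
  AEStronglyMeasurable f μ ∧ ∃ M : ℝ, ∀ᵐ x ∂μ, ‖f x‖ ≤ M

lemma EssBdd.mul {f g : α → ℝ} (hf : EssBdd μ f) (hg : EssBdd μ g) :
    EssBdd μ (fun x => f x * g x) := by
  obtain ⟨hfm, M, hM⟩ := hf
  obtain ⟨hgm, N, hN⟩ := hg
  refine ⟨hfm.mul hgm, M * N, ?_⟩
  filter_upwards [hM, hN] with x h1 h2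
  rw [norm_mul]
  exact mul_le_mul h1 h2 (norm_nonneg _) ((norm_nonneg _).trans h1)

lemma EssBdd.inner {F : Type*} [NormedAddCommGroup F] [InnerProductSpace ℝ F] {f g : α → F}
    (hf : EssBdd μ f) (hg : EssBdd μ g) : EssBdd μ (fun x => inner ℝ (f x) (g x)) := by
  obtain ⟨hfm, M, hM⟩ := hf
  obtain ⟨hgm, N, hN⟩ := hg
  refine ⟨hfm.inner hgm, M * N, ?_⟩
  filter_upwards [hM, hN] with x h1 h2
  exact (norm_inner_le_norm _ _).trans
    (mul_le_mul h1 h2 (norm_nonneg _) ((norm_nonneg _).trans h1))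

lemma EssBdd.integrable [IsFiniteMeasure μ] {f : α → ℝ} (hf : EssBdd μ f) : Integrable f μ := by
  obtain ⟨hfm, M, hM⟩ := hf
  exact Integrable.of_bound hfm M hM

lemma EssBdd.integrable_mul {f g : α → ℝ} (hf : EssBdd μ f) (hg : Integrable g μ) :
    Integrable (fun x => g x * f x) μ := by
  obtain ⟨hfm, M, hM⟩ := hf
  exact hg.mul_bdd hfm hM

end EssBdd

section Variational

variable {W : Type*} [AddCommGroup W] [Module ℝ W]

/-- A definite bilinear form on a finite dimensional space represents every linear functional in
a unique way. -/
lemma existsUnique_of_definite [FiniteDimensional ℝ W] (B : W →ₗ[ℝ] W →ₗ[ℝ] ℝ)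
    (hB : ∀ u, B u u = 0 → u = 0) (ℓ : W →ₗ[ℝ] ℝ) : ∃! u, ∀ v, B u v = ℓ v := by
  have hinj : Function.Injective B := by
    rw [injective_iff_map_eq_zero]
    intro u hu
    exact hB u (by rw [hu]; rfl)
  have hdim : Module.finrank ℝ W = Module.finrank ℝ (W →ₗ[ℝ] ℝ) :=
    (Subspace.dual_finrank_eq (K := ℝ) (V := W)).symm
  have hsurj : Function.Surjective B :=
    (LinearMap.injective_iff_surjective_of_finrank_eq_finrank hdim).1 hinj
  obtain ⟨u, hu⟩ := hsurj ℓ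
  refine ⟨u, fun v => by simp only [hu], fun u' hu' => hinj ?_⟩
  rw [hu]
  exact LinearMap.ext hu'

variable {α : Type*} [MeasurableSpace α]

/-- The bilinear form obtained by integrating an almost everywhere bilinear integrand. -/
noncomputable def integralForm (μ : Measure α) (q : W → W → α → ℝ)
    (hint : ∀ u v, Integrable (q u v) μ)
    (hadd₁ : ∀ u u' v, q (u + u') v =ᵐ[μ] q u v + q u' v)
    (hsmul₁ : ∀ (c : ℝ) u v, q (c • u) v =ᵐ[μ] c • q u v)
    (hadd₂ : ∀ u v v', q u (v + v') =ᵐ[μ] q u v + q u v')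
    (hsmul₂ : ∀ (c : ℝ) u v, q u (c • v) =ᵐ[μ] c • q u v) : W →ₗ[ℝ] W →ₗ[ℝ] ℝ :=
  LinearMap.mk₂ ℝ (fun u v => ∫ x, q u v x ∂μ)
    (fun u u' v => by
      rw [integral_congr_ae (hadd₁ u u' v)]; exact integral_add (hint u v) (hint u' v))
    (fun c u v => by
      rw [integral_congr_ae (hsmul₁ c u v)]; exact integral_smul c _)
    (fun u v v' => by
      rw [integral_congr_ae (hadd₂ u v v')]; exact integral_add (hint u v) (hint u v'))
    (fun c u v => by
      rw [integral_congr_ae (hsmul₂ c u v)]; exact integral_smul c _)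

/-- The functional `v ↦ ∫ g v`. -/
noncomputable def integralFunctional (μ : Measure α) (V : Submodule ℝ (α → ℝ)) (g : α → ℝ)
    (hint : ∀ v ∈ V, Integrable (fun x => g x * v x) μ) : V →ₗ[ℝ] ℝ where
  toFun v := ∫ x, g x * v.1 x ∂μ
  map_add' u v := by
    rw [← integral_add (hint u u.2) (hint v v.2)]
    simp [mul_add]
  map_smul' c v := by
    rw [RingHom.id_apply, ← integral_smul]
    refine integral_congr_ae (Eventually.of_forall fun x => ?_)
    simp only [Submodule.coe_smul, Pi.smul_apply, smul_eq_mul]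
    ring

end Variational

/-! ### The phase field and the weight -/

section Profile

lemma profile_nonneg (r : ℝ) : 0 ≤ profile r := by
  unfold profile
  split_ifs
  · positivity
  · exact le_rfl

lemma profile_le_one (r : ℝ) : profile r ≤ 1 := by
  unfold profile
  split_ifs
  · exact Real.cos_sq_le_one r
  · exact zero_le_one

lemma profile_pos_iff {r : ℝ} : 0 < profile r ↔ |r| < Real.pi / 2 := by
  constructor
  · intro h
    by_contra! hcon
    rcases hcon.eq_or_lt with h' | h'
    · have hcos : Real.cos r = 0 := by rw [← Real.cos_abs, ← h', Real.cos_pi_div_two]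
      simp [profile, hcos] at h
    · simp [profile, not_le.2 h'] at h
  · intro h
    rw [profile, if_pos h.le]
    have := Real.cos_pos_of_mem_Ioo (x := r) (by simpa using abs_lt.1 h)
    positivity

lemma continuous_profile : Continuous profile := by
  refine Continuous.if_le (by fun_prop) continuous_const (by fun_prop) continuous_const ?_
  intro r hr
  rw [← Real.cos_abs, hr, Real.cos_pi_div_two]
  norm_num

end Profile

namespace MovingSurface

variable {n : ℕ} (S : MovingSurface n) {ε t δ : ℝ}

lemma phase_nonneg (ε : ℝ) (x : Amb n) (t : ℝ) : 0 ≤ S.phase ε x t :=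
  indicator_nonneg (fun _ _ => profile_nonneg _) _

lemma phase_le_one (ε : ℝ) (x : Amb n) (t : ℝ) : S.phase ε x t ≤ 1 :=
  indicator_le' (fun _ _ => profile_le_one _) (fun _ _ => zero_le_one) _

/-- With parameter ε this is the support width επ/2 of ρ, with 2ε the width επ of ρ̃; the latter
explains the condition ε < δ/π. -/
lemma phase_pos_iff (hε : 0 < ε) {x : Amb n} :
    0 < S.phase ε x t ↔ x ∈ S.band (ε * Real.pi / 2) t := by
  by_cases hx : x ∈ S.Ω
  · rw [phase, indicator_of_mem hx, profile_pos_iff, abs_div, abs_of_pos hε, div_lt_iff₀ hε]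
    refine ⟨fun h => ⟨hx, by linarith⟩, fun h => ?_⟩
    have := h.2
    linarith
  · simp only [phase, indicator_of_notMem hx, lt_self_iff_false, false_iff]
    exact fun h => hx h.1

lemma phase_eq_zero (hε : 0 < ε) {x : Amb n} (hx : x ∉ S.band (ε * Real.pi / 2) t) :
    S.phase ε x t = 0 :=
  le_antisymm (not_lt.1 fun h => hx ((S.phase_pos_iff hε).1 h)) (S.phase_nonneg _ _ _)

lemma weight_nonneg (ε : ℝ) (x : Amb n) (t : ℝ) : 0 ≤ S.weight ε x t :=
  mul_nonneg (S.phase_nonneg _ _ _) (norm_nonneg _)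

lemma weight_eq_zero (hε : 0 < ε) {x : Amb n} (hx : x ∉ S.band (ε * Real.pi / 2) t) :
    S.weight ε x t = 0 := by
  rw [weight, S.phase_eq_zero hε hx, zero_mul]

lemma weight_pos (ht : t ∈ Icc 0 S.T) (hε : 0 < ε) (hεδ : ε * Real.pi / 2 ≤ S.δ₀) {x : Amb n}
    (hx : x ∈ S.band (ε * Real.pi / 2) t) : 0 < S.weight ε x t :=
  mul_pos ((S.phase_pos_iff hε).2 hx)
    (norm_pos_iff.2 (S.gradAt_ne_zero ht (S.band_mono hεδ t hx)))

lemma norm_weight_le (ht : t ∈ Icc 0 S.T) (hε : 0 < ε) (hεδ : ε * Real.pi / 2 ≤ S.δ₀)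
    (x : Amb n) : ‖S.weight ε x t‖ ≤ S.c₁ := by
  have hc₁ : 0 ≤ S.c₁ := S.c₀_pos.le.trans S.c₀_le
  by_cases hx : x ∈ S.band (ε * Real.pi / 2) t
  · rw [Real.norm_of_nonneg (S.weight_nonneg _ _ _), weight]
    have h1 := S.grad_upper t ht x (S.band_mono hεδ t hx)
    calc _ ≤ 1 * S.c₁ := mul_le_mul (S.phase_le_one _ _ _) h1 (norm_nonneg _) zero_le_one
      _ = S.c₁ := one_mul _
  · rw [S.weight_eq_zero hε hx, norm_zero]
    exact hc₁

lemma aestronglyMeasurable_weight (ht : t ∈ Icc 0 S.T) :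
    AEStronglyMeasurable (fun x => S.weight ε x t) (volume.restrict S.Ω) := by
  have h1 : ContinuousOn (fun x => profile (S.φ x t / ε)) S.Ω :=
    continuous_profile.comp_continuousOn ((S.continuousOn_slice ht).div_const ε)
  have h2 : ContinuousOn (fun x => S.phase ε x t) S.Ω :=
    h1.congr fun x hx => by rw [phase, indicator_of_mem hx]
  exact (h2.mul (S.contDiffOn_gradAt ht).continuousOn.norm).aestronglyMeasurable
    S.isOpen_Ω.measurableSet

lemma essBdd_weight (ht : t ∈ Icc 0 S.T) (hε : 0 < ε) (hεδ : ε * Real.pi / 2 ≤ S.δ₀) :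
    EssBdd (volume.restrict S.Ω) (fun x => S.weight ε x t) :=
  ⟨S.aestronglyMeasurable_weight ht, S.c₁, Eventually.of_forall (S.norm_weight_le ht hε hεδ)⟩

/-- Outside U_δ the extended velocity depends on arbitrary choices, but the weight vanishes there;
only the product is controlled on all of Ω. -/
lemma essBdd_weight_smul_velExt (ht : t ∈ Ioc 0 S.T) (hδ : δ < S.δ₀) (hε : 0 < ε)
    (hεδ : ε * Real.pi / 2 ≤ δ) :
    EssBdd (volume.restrict S.Ω) (fun x => S.weight ε x t • S.velExt δ x t) := by
  have ht' := Ioc_subset_Icc_self ht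
  obtain ⟨C, hC0, hC⟩ := S.exists_bound_velExt hδ
  have hb : S.band (ε * Real.pi / 2) t ⊆ S.band δ t := S.band_mono hεδ t
  have hm : MeasurableSet (S.band δ t) := (S.isOpen_band ht' δ).measurableSet
  have hind : (fun x => S.weight ε x t • S.velExt δ x t) =
      (S.band δ t).indicator (fun x => S.weight ε x t • S.velExt δ x t) := by
    funext x
    by_cases hx : x ∈ S.band δ t
    · rw [indicator_of_mem hx]
    · rw [indicator_of_notMem hx, S.weight_eq_zero hε (fun h => hx (hb h)), zero_smul]
  constructor
  · rw [hind, aestronglyMeasurable_indicator_iff hm, Measure.restrict_restrict hm,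
      inter_eq_left.2 (S.band_subset δ t)]
    exact ((S.aestronglyMeasurable_weight ht').mono_measure
      (Measure.restrict_mono (S.band_subset δ t) le_rfl)).smul
        ((S.continuousOn_velExt ht hδ).aestronglyMeasurable hm)
  · refine ⟨S.c₁ * C, Eventually.of_forall fun x => ?_⟩
    have hc₁ : 0 ≤ S.c₁ := S.c₀_pos.le.trans S.c₀_le
    by_cases hx : x ∈ S.band δ t
    · rw [norm_smul]
      exact mul_le_mul (S.norm_weight_le ht' hε (hεδ.trans hδ.le) x) (hC t ht x hx)
        (norm_nonneg _) hc₁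
    · simp only [S.weight_eq_zero hε (fun h => hx (hb h)), zero_smul, norm_zero]
      positivity

instance : IsFiniteMeasure (volume.restrict S.Ω) :=
  ⟨by simpa using S.isBounded_Ω.measure_lt_top⟩

lemma integrable_ext {f : Amb n → ℝ → ℝ} (ht : t ∈ Icc 0 S.T)
    (hf : IntegrableOn (fun x => S.ext δ f x t) (S.band δ t)) :
    Integrable (fun x => S.ext δ f x t) := by
  have hm : MeasurableSet (S.band δ t) := (S.isOpen_band ht δ).measurableSet
  have hind : (fun x => S.ext δ f x t) = (S.band δ t).indicator (fun x => S.ext δ f x t) := by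
    funext x
    by_cases hx : x ∈ S.band δ t
    · rw [indicator_of_mem hx]
    · rw [indicator_of_notMem hx, ext, if_neg hx]
  rw [hind]
  exact hf.integrable_indicator hm

end MovingSurface

lemma femSpace.essBdd {n : ℕ} {C : Set (Finset (Amb n))} (hC : C.Finite) {u : Amb n → ℝ}
    (hu : u ∈ femSpace C) (A : Set (Amb n)) : EssBdd (volume.restrict A) u := by
  obtain ⟨M, hM⟩ := femSpace.exists_bound hC hu
  exact ⟨(femSpace.measurable hC hu).aestronglyMeasurable, M, Eventually.of_forall hM⟩

lemma femSpace.essBdd_gradient {n : ℕ} {C : Set (Finset (Amb n))} (hC : C.Finite)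
    {u : Amb n → ℝ} (hu : u ∈ femSpace C) (A : Set (Amb n)) :
    EssBdd (volume.restrict A) (gradient u) := by
  obtain ⟨M, hM⟩ := femSpace.ae_norm_gradient_le hC hu
  exact ⟨(measurable_gradient u).aestronglyMeasurable, M, ae_restrict_of_ae hM⟩

/-- A nonempty open set has positive measure. One good point suffices later, as gradients of finite
element functions are constant inside each cell. -/
lemma exists_mem_of_ae_restrict {E : Type*} [MeasurableSpace E] [TopologicalSpace E]
    [OpensMeasurableSpace E] {μ : Measure E} [μ.IsOpenPosMeasure] {A U : Set E} {p : E → Prop}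
    (h : ∀ᵐ x ∂μ.restrict A, p x) (hU : IsOpen U) (hne : U.Nonempty) (hUA : U ⊆ A) :
    ∃ x ∈ U, p x := by
  have h1 : ∀ᵐ x ∂μ.restrict U, p x := ae_restrict_of_ae_restrict_of_subset hUA h
  rw [ae_restrict_iff' hU.measurableSet] at h1
  by_contra! hcon
  have h2 : ∀ᵐ x ∂μ, x ∉ U := by
    filter_upwards [h1] with x hx hxU using hcon x hxU (hx hxU)
  exact hU.measure_ne_zero μ hne (measure_eq_zero_iff_ae_notMem.2 h2)

/-! ### Propagation of zeros through the active cells -/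

namespace MovingSurface

variable {n : ℕ} (S : MovingSurface n) {K : Geometry.SimplicialComplex ℝ (Amb n)}
  {ε t δ σ : ℝ}

lemma activeCells_subset : S.activeCells K ε t ⊆ cells K := fun _ hs => hs.1

lemma finite_activeCells (hK : IsTriangulation S.Ω K) : (S.activeCells K ε t).Finite :=
  hK.finite_cells.subset S.activeCells_subset

lemma interp_mem_femSpace (hK : IsTriangulation S.Ω K) (f : Amb n → ℝ) :
    S.interp K ε t f ∈ femSpace (S.activeCells K ε t) ∧
      ∀ s ∈ S.activeCells K ε t, ∀ x ∈ s, S.interp K ε t f x = f x := by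
  obtain ⟨w, hw, hwf⟩ := femSpace.exists_interpolant S.activeCells_subset
    (S.finite_activeCells (ε := ε) (t := t) hK) f
  have hspec := Classical.epsilon_spec (p := fun w => w ∈ S.feSpace K ε t ∧
    ∀ x ∈ S.discreteBand K ε t ∩ K.vertices, w x = f x) ⟨w, hw, fun x hx => by
      obtain ⟨s, hs, hxs⟩ := mem_region.1 hx.1
      exact hwf s hs x (mem_of_mem_vertices_of_mem_simplex hs.1 hx.2 hxs)⟩
  exact ⟨hspec.1, fun s hs x hx => hspec.2 x
    ⟨simplex_subset_region hs (mem_simplex_of_mem hx), mem_vertices_of_mem_cell hs.1 hx⟩⟩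

lemma interp_phase_nonneg (hK : IsTriangulation S.Ω K) (x : Amb n) :
    0 ≤ S.interp K ε t (fun y => S.phase (2 * ε) y t) x := by
  obtain ⟨h1, h2⟩ := S.interp_mem_femSpace (ε := ε) (t := t) hK (fun y => S.phase (2 * ε) y t)
  refine femSpace.nonneg S.activeCells_subset h1 (fun s hs y hy => ?_) x
  rw [h2 s hs y hy]
  exact S.phase_nonneg _ _ _

lemma interp_phase_pos (hK : IsTriangulation S.Ω K) {s : Finset (Amb n)}
    (hs : s ∈ S.activeCells K ε t) {x : Amb n} (hx : x ∈ interior (simplex s)) :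
    0 < S.interp K ε t (fun y => S.phase (2 * ε) y t) x := by
  obtain ⟨h1, h2⟩ := S.interp_mem_femSpace (ε := ε) (t := t) hK (fun y => S.phase (2 * ε) y t)
  refine femSpace.pos_of_mem_interior S.activeCells_subset h1 hs (fun y hy => ?_) ?_ hx
  · rw [h2 s hs y hy]
    exact S.phase_nonneg _ _ _
  · obtain ⟨y, hy, hpos⟩ := hs.2
    exact ⟨y, hy, by rwa [h2 s hs y hy]⟩

/-- A vertex in `U_δ` belongs to a cell that either meets the zero level set or has a vertex at
which the level set function is smaller in absolute value. -/
lemma exists_cell_descent (ht : t ∈ Icc 0 S.T) (hK : IsTriangulation S.Ω K) (hσ : 0 < σ)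
    (hreg : IsShapeRegular σ K) (hmesh₁ : δ + S.c₁ * meshSize K ≤ S.δ₀)
    (hmesh₂ : S.c₂ * meshSize K < S.c₀ * (σ / (4 * (n + 2)))) {x : Amb n} (hx : x ∈ K.vertices)
    (hxb : x ∈ S.band δ t) :
    ∃ s ∈ cells K, x ∈ s ∧ ((∃ y ∈ simplex s, y ∈ S.surf t) ∨
      ∃ z ∈ s, z ∈ S.band |S.φ x t| t) := by
  by_cases hx0 : S.φ x t = 0
  · obtain ⟨s, hs, hxs, -⟩ := hK.exists_cell_direction S.isOpen_Ω hx hxb.1 0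
    exact ⟨s, hs, hxs, Or.inl ⟨x, mem_simplex_of_mem hxs, hxb.1, hx0⟩⟩
  have hmesh0 : 0 ≤ meshSize K := by
    obtain ⟨s, hs, -⟩ := hK.exists_mem_simplex hxb.1
    exact Metric.diam_nonneg.trans (hK.diam_le_meshSize hs)
  have hc₁ : 0 ≤ S.c₁ := S.c₀_pos.le.trans S.c₀_le
  have hxδ₀ : x ∈ S.band S.δ₀ t := S.band_mono (by nlinarith [mul_nonneg hc₁ hmesh0]) t hxb
  obtain ⟨θ, hθ, hθφ⟩ : ∃ θ : ℝ, |θ| = 1 ∧ θ * S.φ x t = |S.φ x t| := by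
    rcases le_total 0 (S.φ x t) with h | h
    · exact ⟨1, by simp, by rw [abs_of_nonneg h, one_mul]⟩
    · exact ⟨-1, by simp, by rw [abs_of_nonpos h]; ring⟩
  set G := gradAt S.φ x t with hG
  have hGpos : 0 < ‖G‖ := norm_pos_iff.2 (S.gradAt_ne_zero ht hxδ₀)
  -- With θ the sign of φ(x), this is the unit direction of steepest descent of |φ|.
  set d : Amb n := (-θ * ‖G‖⁻¹) • G with hd
  have hdn : ‖d‖ = 1 := by
    rw [hd, norm_smul, norm_mul, norm_neg, norm_inv, norm_norm, Real.norm_eq_abs, hθ, one_mul,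
      inv_mul_cancel₀ hGpos.ne']
  obtain ⟨s, hs, hxs, r, hr, hxr⟩ := hK.exists_cell_direction S.isOpen_Ω hx hxb.1 d
  obtain ⟨z, hz, hzx, hdir⟩ := exists_edge_direction hs hσ (hreg s hs) hxs hdn hr hxr
  refine ⟨s, hs, hxs, ?_⟩
  have hzn : ‖z - x‖ ≤ meshSize K :=
    (norm_sub_le_diam (mem_simplex_of_mem hxs) (mem_simplex_of_mem hz)).trans
      (hK.diam_le_meshSize hs)
  have hzpos : 0 < ‖z - x‖ := norm_pos_iff.2 (sub_ne_zero.2 hzx)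
  have hball := S.ball_subset_band ht hxb hmesh₁
  have hzb : z ∈ S.band S.δ₀ t := hball (by simpa [dist_eq_norm] using hzn)
  have hinner : θ * inner ℝ G (z - x) = -(‖G‖ * inner ℝ d (z - x)) := by
    rw [hd, real_inner_smul_left]
    field_simp
  have htaylor := S.taylor_le ht hxb hmesh₁ hzn
  -- The gain is at least c₀ σ/(4(n + 2)) ‖z − x‖, the remainder at most c₂ ‖z − x‖²; `hmesh₂` makes
  -- the gain win.
  have hdec : θ * S.φ z t < |S.φ x t| := by
    have h1 : θ * (S.φ z t - S.φ x t - inner ℝ G (z - x)) ≤ S.c₂ * ‖z - x‖ ^ 2 := by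
      refine (le_abs_self _).trans ?_
      rw [abs_mul, hθ, one_mul]
      exact htaylor
    have h2 : S.c₀ * (σ / (4 * (n + 2)) * ‖z - x‖) ≤ ‖G‖ * inner ℝ d (z - x) :=
      mul_le_mul (S.grad_lower t ht x hxδ₀) hdir (by positivity) hGpos.le
    have h3 : S.c₂ * ‖z - x‖ ^ 2 < S.c₀ * (σ / (4 * (n + 2)) * ‖z - x‖) := by
      have : S.c₂ * ‖z - x‖ < S.c₀ * (σ / (4 * (n + 2))) :=
        (mul_le_mul_of_nonneg_left hzn S.c₂_pos.le).trans_lt hmesh₂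
      nlinarith
    rw [mul_sub, mul_sub, hinner, hθφ] at h1
    linarith
  -- Either |φ(z)| < |φ(x)|, or the step overshoots; then φ changes sign along the edge, and the
  -- intermediate value theorem gives a point of Γ(t) in the cell.
  by_cases hlow : -|S.φ x t| < θ * S.φ z t
  · refine Or.inr ⟨z, hz, hzb.1, ?_⟩
    have : |θ * S.φ z t| < |S.φ x t| := abs_lt.2 ⟨hlow, hdec⟩
    rwa [abs_mul, hθ, one_mul] at this
  · left
    have hxpos : 0 < |S.φ x t| := abs_pos.2 hx0
    have hseg : segment ℝ z x ⊆ Metric.closedBall x (meshSize K) :=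
      (convex_closedBall _ _).segment_subset (by simpa [dist_eq_norm] using hzn)
        (Metric.mem_closedBall_self hmesh0)
    have hcont : ContinuousOn (fun y => θ * S.φ y t) (segment ℝ z x) :=
      continuousOn_const.mul ((S.continuousOn_slice ht).mono fun y hy => (hball (hseg hy)).1)
    obtain ⟨y, hy, hy0⟩ := (convex_segment (𝕜 := ℝ) z x).isPreconnected.intermediate_value
      (left_mem_segment ℝ z x) (right_mem_segment ℝ z x) hcont
      (show (0 : ℝ) ∈ Icc _ _ from ⟨by linarith [not_lt.1 hlow], by rw [hθφ]; exact hxpos.le⟩)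
    have hθ0 : θ ≠ 0 := by
      intro h
      simp [h] at hθ
    exact ⟨y, (convex_simplex s).segment_subset (mem_simplex_of_mem hz) (mem_simplex_of_mem hxs) hy,
      (hball (hseg hy)).1, (mul_eq_zero.1 hy0).resolve_left hθ0⟩

/-- A finite element function that vanishes where the weight is positive, and whose gradient
vanishes where the interpolated phase field is positive, is zero. -/
lemma femSpace_eq_zero (ht : t ∈ Icc 0 S.T) (hK : IsTriangulation S.Ω K) (hσ : 0 < σ)
    (hreg : IsShapeRegular σ K) (hδ : δ < S.δ₀) (hmesh₁ : δ + S.c₁ * meshSize K ≤ S.δ₀)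
    (hmesh₂ : S.c₂ * meshSize K < S.c₀ * (σ / (4 * (n + 2))))
    (hε : 0 < ε) (hεδ : ε * Real.pi < δ) {u : Amb n → ℝ}
    (hu : u ∈ femSpace (S.activeCells K ε t))
    (h₁ : ∀ᵐ x ∂volume.restrict S.Ω, u x ^ 2 * S.weight ε x t = 0)
    (h₂ : ∀ᵐ x ∂volume.restrict S.Ω,
      S.interp K ε t (fun y => S.phase (2 * ε) y t) x * ‖gradient u x‖ ^ 2 = 0) : u = 0 := by
  have hεπ : 0 < ε * Real.pi := mul_pos hε Real.pi_pos
  have hmeet : ∀ s ∈ cells K, ∀ U : Set (Amb n), IsOpen U → (simplex s ∩ U).Nonempty →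
      (interior (simplex s) ∩ U).Nonempty := by
    rintro s hs U hU ⟨y, hy, hyU⟩
    obtain ⟨z, hzU, hz⟩ := mem_closure_iff.1 (simplex_subset_closure_interior hs hy) U hU hyU
    exact ⟨z, hz, hzU⟩
  -- The interpolated ρ̃ is positive inside an active cell, so the constant gradient there must
  -- vanish.
  have hconst : ∀ s ∈ S.activeCells K ε t, ∃ c : ℝ, ∀ x ∈ simplex s, u x = c := by
    intro s hs
    obtain ⟨g, c, hg⟩ := femSpace.exists_gradient hu hs
    have hne : (interior (simplex s) ∩ S.Ω).Nonempty := by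
      obtain ⟨y, hy⟩ := interior_simplex_nonempty hs.1
      exact mem_closure_iff.1 (hK.simplex_subset hs.1 (interior_subset hy)) _ isOpen_interior hy
    obtain ⟨x, hx, hx0⟩ := exists_mem_of_ae_restrict h₂
      (isOpen_interior.inter S.isOpen_Ω) hne inter_subset_right
    rw [(hasGradientAt_of_eqOn_inner hg hx.1).gradient] at hx0
    have hg0 : g = 0 := by
      have := (mul_eq_zero.1 hx0).resolve_left (S.interp_phase_pos hK hs hx.1).ne'
      simpa using this
    exact ⟨c, fun x hx => by rw [hg x hx, hg0, inner_zero_left, zero_add]⟩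
  -- The weight is positive on an open band around Γ(t), and this band meets the interior of the
  -- cell.
  have hsurf : ∀ s ∈ S.activeCells K ε t, (∃ y ∈ simplex s, y ∈ S.surf t) →
      ∀ x ∈ simplex s, u x = 0 := by
    rintro s hs ⟨y, hys, hy⟩ x hx
    obtain ⟨c, hc⟩ := hconst s hs
    have hyb : y ∈ S.band (ε * Real.pi / 2) t := ⟨hy.1, by rw [hy.2, abs_zero]; linarith⟩
    obtain ⟨z, hz, hz0⟩ := exists_mem_of_ae_restrict h₁
      (isOpen_interior.inter (S.isOpen_band ht _)) (hmeet s hs.1 _ (S.isOpen_band ht _) ⟨y, hys, hyb⟩)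
      (inter_subset_right.trans (S.band_subset _ _))
    have hz0' : u z = 0 := by
      have := (mul_eq_zero.1 hz0).resolve_right
        (S.weight_pos ht hε (by linarith) hz.2).ne'
      simpa using this
    rw [hc x hx, ← hc z (interior_subset hz.1), hz0']
  have hactive : ∀ x : Amb n, x ∈ S.band (ε * Real.pi) t → 0 < S.phase (2 * ε) x t := by
    intro x hx
    rw [S.phase_pos_iff (by linarith)]
    convert hx using 2
    ring
  -- Take a vertex with u ≠ 0 and minimal |φ|. The cell given by the descent is active because of
  -- this very vertex, so u is constant on it: either u is 0 there, or u ≠ 0 at a vertex with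
  -- smaller |φ|.
  have hvert : ∀ s ∈ cells K, ∀ x ∈ s, x ∈ S.band (ε * Real.pi) t → u x = 0 := by
    by_contra! hcon
    set N : Set (Amb n) := {x | (∃ s ∈ cells K, x ∈ s) ∧ x ∈ S.band (ε * Real.pi) t ∧ u x ≠ 0}
      with hN
    have hNf : N.Finite := by
      refine (hK.finite_cells.biUnion fun s _ => s.finite_toSet).subset fun x hx => ?_
      obtain ⟨s, hs, hxs⟩ := hx.1
      exact mem_biUnion hs hxs
    have hNne : N.Nonempty := by
      obtain ⟨s, hs, x, hxs, hx, hux⟩ := hcon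
      exact ⟨x, ⟨s, hs, hxs⟩, hx, hux⟩
    obtain ⟨x, ⟨⟨s₀, hs₀, hxs₀⟩, hxb, hux⟩, hmin⟩ := exists_min_image N (fun x => |S.φ x t|) hNf hNne
    obtain ⟨s, hs, hxs, hcase⟩ := S.exists_cell_descent ht hK hσ hreg hmesh₁ hmesh₂
      (mem_vertices_of_mem_cell hs₀ hxs₀) (S.band_mono hεδ.le t hxb)
    have hsa : s ∈ S.activeCells K ε t := ⟨hs, x, hxs, hactive x hxb⟩
    rcases hcase with hy | ⟨z, hz, hzb⟩
    · exact hux (hsurf s hsa hy x (mem_simplex_of_mem hxs))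
    · obtain ⟨c, hc⟩ := hconst s hsa
      refine absurd (hmin z ⟨⟨s, hs, hz⟩, S.band_mono hxb.2.le t hzb, ?_⟩) (not_le.2 hzb.2)
      rw [hc z (mem_simplex_of_mem hz), ← hc x (mem_simplex_of_mem hxs)]
      exact hux
  funext x
  by_cases hx : x ∈ region (S.activeCells K ε t)
  · obtain ⟨s, hs, hxs⟩ := mem_region.1 hx
    obtain ⟨c, hc⟩ := hconst s hs
    -- An active cell may have vertices outside U_{επ}, but it has at least one inside, and u is
    -- constant on it.
    obtain ⟨z, hz, hzpos⟩ := hs.2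
    have hzb : z ∈ S.band (ε * Real.pi) t := by
      rw [S.phase_pos_iff (by linarith)] at hzpos
      convert hzpos using 2
      ring
    rw [hc x hxs, ← hc z (mem_simplex_of_mem hz), hvert s hs.1 z hz hzb, Pi.zero_apply]
  · exact hu.2.2 x hx

end MovingSurface

section Gradients

variable {n : ℕ} {u v : Amb n → ℝ} {x : Amb n}

lemma gradient_add_of_differentiableAt (hu : DifferentiableAt ℝ u x)
    (hv : DifferentiableAt ℝ v x) : gradient (u + v) x = gradient u x + gradient v x := by
  simp only [gradient]
  rw [fderiv_add hu hv, map_add]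

lemma gradient_smul_of_differentiableAt (hu : DifferentiableAt ℝ u x) (c : ℝ) :
    gradient (c • u) x = c • gradient u x := by
  simp only [gradient]
  rw [fderiv_const_smul hu, map_smul]

end Gradients

lemma existsUnique_of_subtype {α : Type*} {V : Set α} {p : α → Prop}
    (h : ∃! u : V, p u.1) : ∃! u, u ∈ V ∧ p u := by
  obtain ⟨u, hu, huniq⟩ := h
  exact ⟨u.1, ⟨u.2, hu⟩, fun w hw => congrArg Subtype.val (huniq ⟨w, hw.1⟩ hw.2)⟩

/-! ### Unique solvability of one time step and of the initial projection -/

namespace MovingSurface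

variable {n : ℕ} (S : MovingSurface n) {K : Geometry.SimplicialComplex ℝ (Amb n)}
  {ε t t' δ σ γ : ℝ}

/-- The integrand of the bilinear form of the scheme, with time step `τ`. -/
noncomputable def stepIntegrand (K : Geometry.SimplicialComplex ℝ (Amb n)) (δ ε γ τ t : ℝ)
    (u v : Amb n → ℝ) (x : Amb n) : ℝ :=
  u x * v x * S.weight ε x t
    + τ * (inner ℝ (gradient u x) (gradient v x) * S.weight ε x t)
    - τ * (u x * inner ℝ (S.velExt δ x t) (gradient v x) * S.weight ε x t)
    + γ * τ ^ 2 * (S.interp K ε t (fun y => S.phase (2 * ε) y t) x *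
        inner ℝ (gradient u x) (gradient v x))

lemma integrable_stabilization (hK : IsTriangulation S.Ω K) {u v : Amb n → ℝ}
    (hu : u ∈ femSpace (S.activeCells K ε t)) (hv : v ∈ femSpace (S.activeCells K ε t)) :
    Integrable (fun x => S.interp K ε t (fun y => S.phase (2 * ε) y t) x *
      inner ℝ (gradient u x) (gradient v x)) (volume.restrict S.Ω) := by
  have hf := S.finite_activeCells (ε := ε) (t := t) hK
  exact ((femSpace.essBdd hf (S.interp_mem_femSpace hK _).1 _).mul
    ((femSpace.essBdd_gradient hf hu _).inner (femSpace.essBdd_gradient hf hv _))).integrable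

section Integrability

variable {u v : Amb n → ℝ} (hK : IsTriangulation S.Ω K) (hε : 0 < ε)
  (hu : u ∈ femSpace (S.activeCells K ε t)) (hv : v ∈ femSpace (S.activeCells K ε t))
include hK hε hu hv

lemma integrable_mass (ht : t ∈ Icc 0 S.T) (hεδ : ε * Real.pi / 2 ≤ S.δ₀) :
    Integrable (fun x => u x * v x * S.weight ε x t) (volume.restrict S.Ω) := by
  have hf := S.finite_activeCells (ε := ε) (t := t) hK
  exact (((femSpace.essBdd hf hu _).mul (femSpace.essBdd hf hv _)).mul
    (S.essBdd_weight ht hε hεδ)).integrable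

lemma integrable_stiffness (ht : t ∈ Icc 0 S.T) (hεδ : ε * Real.pi / 2 ≤ S.δ₀) :
    Integrable (fun x => inner ℝ (gradient u x) (gradient v x) * S.weight ε x t)
      (volume.restrict S.Ω) := by
  have hf := S.finite_activeCells (ε := ε) (t := t) hK
  exact (((femSpace.essBdd_gradient hf hu _).inner (femSpace.essBdd_gradient hf hv _)).mul
    (S.essBdd_weight ht hε hεδ)).integrable

lemma integrable_advection (ht : t ∈ Ioc 0 S.T) (hδ : δ < S.δ₀) (hεδ : ε * Real.pi / 2 ≤ δ) :
    Integrable (fun x => u x * inner ℝ (S.velExt δ x t) (gradient v x) * S.weight ε x t)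
      (volume.restrict S.Ω) := by
  have hf := S.finite_activeCells (ε := ε) (t := t) hK
  refine ((femSpace.essBdd hf hu _).mul ((S.essBdd_weight_smul_velExt ht hδ hε hεδ).inner
    (femSpace.essBdd_gradient hf hv _))).integrable.congr (Eventually.of_forall fun x => ?_)
  simp only [real_inner_smul_left]
  ring

lemma integrable_stepIntegrand (ht : t ∈ Ioc 0 S.T) (hδ : δ < S.δ₀)
    (hεδ : ε * Real.pi / 2 ≤ δ) (τ : ℝ) :
    Integrable (S.stepIntegrand K δ ε γ τ t u v) (volume.restrict S.Ω) :=
  (((S.integrable_mass hK hε hu hv (Ioc_subset_Icc_self ht) (hεδ.trans hδ.le)).add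
    ((S.integrable_stiffness hK hε hu hv (Ioc_subset_Icc_self ht) (hεδ.trans hδ.le)).const_mul
      τ)).sub ((S.integrable_advection hK hε hu hv ht hδ hεδ).const_mul τ)).add
    ((S.integrable_stabilization hK hu hv).const_mul _)

lemma integral_stepIntegrand (ht : t ∈ Ioc 0 S.T) (hδ : δ < S.δ₀)
    (hεδ : ε * Real.pi / 2 ≤ δ) (τ : ℝ) :
    ∫ x in S.Ω, S.stepIntegrand K δ ε γ τ t u v x =
      (∫ x in S.Ω, u x * v x * S.weight ε x t)
      + τ * (∫ x in S.Ω, inner ℝ (gradient u x) (gradient v x) * S.weight ε x t)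
      - τ * (∫ x in S.Ω, u x * inner ℝ (S.velExt δ x t) (gradient v x) * S.weight ε x t)
      + γ * τ ^ 2 * (∫ x in S.Ω, S.interp K ε t (fun y => S.phase (2 * ε) y t) x *
          inner ℝ (gradient u x) (gradient v x)) := by
  have h1 := S.integrable_mass hK hε hu hv (Ioc_subset_Icc_self ht) (hεδ.trans hδ.le)
  have h2 := (S.integrable_stiffness hK hε hu hv (Ioc_subset_Icc_self ht)
    (hεδ.trans hδ.le)).const_mul τ
  have h3 := (S.integrable_advection hK hε hu hv ht hδ hεδ).const_mul τ
  have h4 := (S.integrable_stabilization hK hu hv).const_mul (γ * τ ^ 2)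
  refine (integral_add ((h1.add h2).sub h3) h4).trans ?_
  rw [integral_sub' (h1.add h2) h3, integral_add' h1 h2,
    integral_const_mul, integral_const_mul, integral_const_mul]

end Integrability

/-- The bilinear form of the scheme. -/
noncomputable def stepForm (hK : IsTriangulation S.Ω K) (hε : 0 < ε) (ht : t ∈ Ioc 0 S.T)
    (hδ : δ < S.δ₀) (hεδ : ε * Real.pi / 2 ≤ δ) (γ τ : ℝ) :
    femSpace (S.activeCells K ε t) →ₗ[ℝ] femSpace (S.activeCells K ε t) →ₗ[ℝ] ℝ :=
  -- The gradient is 0 by default where u is not differentiable, so it is linear only off the null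
  -- set of cell boundaries; the form is bilinear after integration.
  have hdiff (u : femSpace (S.activeCells K ε t)) :
      ∀ᵐ x ∂volume.restrict S.Ω, DifferentiableAt ℝ u.1 x :=
    ae_restrict_of_ae (femSpace.ae_differentiableAt (S.finite_activeCells hK) u.2)
  integralForm (volume.restrict S.Ω)
    (fun u v => S.stepIntegrand K δ ε γ τ t u.1 v.1)
    (fun u v => S.integrable_stepIntegrand hK hε u.2 v.2 ht hδ hεδ τ)
    (fun u u' v => by
      filter_upwards [hdiff u, hdiff u'] with x hx hx'
      simp only [stepIntegrand, Submodule.coe_add, Pi.add_apply,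
        gradient_add_of_differentiableAt hx hx', inner_add_left]
      ring)
    (fun c u v => by
      filter_upwards [hdiff u] with x hx
      simp only [stepIntegrand, Submodule.coe_smul, Pi.smul_apply, smul_eq_mul,
        gradient_smul_of_differentiableAt hx, real_inner_smul_left]
      ring)
    (fun u v v' => by
      filter_upwards [hdiff v, hdiff v'] with x hx hx'
      simp only [stepIntegrand, Submodule.coe_add, Pi.add_apply,
        gradient_add_of_differentiableAt hx hx', inner_add_right]
      ring)
    (fun c u v => by
      filter_upwards [hdiff v] with x hx
      simp only [stepIntegrand, Submodule.coe_smul, Pi.smul_apply, smul_eq_mul,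
        gradient_smul_of_differentiableAt hx, real_inner_smul_right]
      ring)

/-- Pointwise coercivity of the integrand for small time steps. -/
lemma stepIntegrand_self_ge (hε : 0 < ε) (hεδ : ε * Real.pi / 2 ≤ δ) {C τ : ℝ}
    (hC : ∀ x ∈ S.band δ t, ‖S.velExt δ x t‖ ≤ C) (hτ : 0 ≤ τ)
    (u : Amb n → ℝ) (x : Amb n) :
    (1 - τ * C ^ 2 / 4) * (u x ^ 2 * S.weight ε x t)
      + γ * τ ^ 2 * (S.interp K ε t (fun y => S.phase (2 * ε) y t) x * ‖gradient u x‖ ^ 2)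
      ≤ S.stepIntegrand K δ ε γ τ t u u x := by
  rw [stepIntegrand, real_inner_self_eq_norm_sq]
  by_cases hx : x ∈ S.band (ε * Real.pi / 2) t
  · have hw := S.weight_nonneg ε x t
    have hv := hC x (S.band_mono hεδ t hx)
    -- Young's inequality with coefficient 1 on |∇u|² uses up the whole diffusion term. Control of
    -- ∇u is left to the stabilization, which also acts where ρ vanishes.
    have h1 : u x * inner ℝ (S.velExt δ x t) (gradient u x) ≤
        C ^ 2 / 4 * u x ^ 2 + ‖gradient u x‖ ^ 2 := by
      have h2 : u x * inner ℝ (S.velExt δ x t) (gradient u x) ≤ |u x| * (C * ‖gradient u x‖) := by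
        refine (le_abs_self _).trans ?_
        rw [abs_mul]
        refine mul_le_mul_of_nonneg_left ((abs_real_inner_le_norm _ _).trans ?_) (abs_nonneg _)
        exact mul_le_mul_of_nonneg_right hv (norm_nonneg _)
      have h3 := sq_nonneg (C / 2 * |u x| - ‖gradient u x‖)
      have h4 := sq_abs (u x)
      nlinarith
    have h5 := mul_le_mul_of_nonneg_right h1 (mul_nonneg hτ hw)
    nlinarith
  · rw [S.weight_eq_zero hε hx]
    simp

/-- Unique solvability of one step of the scheme. -/
theorem existsUnique_stepEq (hK : IsTriangulation S.Ω K) (hσ : 0 < σ)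
    (hreg : IsShapeRegular σ K) (hδ : δ < S.δ₀) (hmesh₁ : δ + S.c₁ * meshSize K ≤ S.δ₀)
    (hmesh₂ : S.c₂ * meshSize K < S.c₀ * (σ / (4 * (n + 2)))) (hε : 0 < ε)
    (hεδ : ε * Real.pi < δ) (hγ : 0 < γ) (ht' : t' ∈ Icc 0 S.T) (ht : t ∈ Ioc 0 S.T)
    (htt : t' < t) {C : ℝ} (hC : ∀ x ∈ S.band δ t, ‖S.velExt δ x t‖ ≤ C)
    (hτ : (t - t') * C ^ 2 < 4) {f : Amb n → ℝ → ℝ}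
    (hf : IntegrableOn (fun x => S.ext δ f x t) (S.band δ t)) {w : Amb n → ℝ}
    (hw : w ∈ S.feSpace K ε t') :
    ∃! u : Amb n → ℝ, u ∈ S.feSpace K ε t ∧ S.StepEq K δ ε γ f t' t w u := by
  have hεπ : 0 < ε * Real.pi := mul_pos hε Real.pi_pos
  have hεδ' : ε * Real.pi / 2 ≤ δ := by linarith
  have hε₀ : ε * Real.pi / 2 ≤ S.δ₀ := hεδ'.trans hδ.le
  have htI := Ioc_subset_Icc_self ht
  have hτ0 : 0 < t - t' := sub_pos.2 htt
  have hfin := S.finite_activeCells (ε := ε) (t := t) hK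
  have hfin' := S.finite_activeCells (ε := ε) (t := t') hK
  have : FiniteDimensional ℝ (femSpace (S.activeCells K ε t)) := femSpace.finiteDimensional hfin
  have hint₁ : ∀ v ∈ femSpace (S.activeCells K ε t),
      Integrable (fun x => w x * S.weight ε x t' * v x) (volume.restrict S.Ω) := fun v hv =>
    (((femSpace.essBdd hfin' hw _).mul (S.essBdd_weight ht' hε hε₀)).mul
      (femSpace.essBdd hfin hv _)).integrable
  have hint₂ : ∀ v ∈ femSpace (S.activeCells K ε t),
      Integrable (fun x => S.ext δ f x t * S.weight ε x t * v x) (volume.restrict S.Ω) :=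
    fun v hv => (femSpace.essBdd hfin hv _).integrable_mul
      ((S.essBdd_weight htI hε hε₀).integrable_mul (S.integrable_ext htI hf).restrict)
  set ℓ := integralFunctional (volume.restrict S.Ω) _ _ hint₁ +
    (t - t') • integralFunctional (volume.restrict S.Ω) _ _ hint₂ with hℓ
  set B := S.stepForm hK hε ht hδ hεδ' γ (t - t') with hB
  have hdef : ∀ u, B u u = 0 → u = 0 := by
    intro u hBu
    set η := S.interp K ε t (fun y => S.phase (2 * ε) y t) with hη
    set κ := 1 - (t - t') * C ^ 2 / 4 with hκ
    have hκ0 : 0 < κ := by rw [hκ]; linarith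
    have hlow : ∀ x, κ * (u.1 x ^ 2 * S.weight ε x t)
        + γ * (t - t') ^ 2 * (η x * ‖gradient u.1 x‖ ^ 2)
        ≤ S.stepIntegrand K δ ε γ (t - t') t u.1 u.1 x :=
      fun x => S.stepIntegrand_self_ge hε hεδ' hC hτ0.le u.1 x
    have hm0 : ∀ x, 0 ≤ u.1 x ^ 2 * S.weight ε x t := fun x =>
      mul_nonneg (sq_nonneg _) (S.weight_nonneg _ _ _)
    have hs0 : ∀ x, 0 ≤ η x * ‖gradient u.1 x‖ ^ 2 := fun x =>
      mul_nonneg (S.interp_phase_nonneg hK x) (sq_nonneg _)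
    have hγτ : 0 < γ * (t - t') ^ 2 := by positivity
    have hq0 : ∀ x, 0 ≤ S.stepIntegrand K δ ε γ (t - t') t u.1 u.1 x := fun x =>
      (add_nonneg (mul_nonneg hκ0.le (hm0 x)) (mul_nonneg hγτ.le (hs0 x))).trans (hlow x)
    have hae : S.stepIntegrand K δ ε γ (t - t') t u.1 u.1 =ᵐ[volume.restrict S.Ω] 0 :=
      (integral_eq_zero_iff_of_nonneg hq0
        (S.integrable_stepIntegrand hK hε u.2 u.2 ht hδ hεδ' (t - t'))).1 hBu
    have hboth : ∀ᵐ x ∂volume.restrict S.Ω, u.1 x ^ 2 * S.weight ε x t = 0 ∧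
        η x * ‖gradient u.1 x‖ ^ 2 = 0 := by
      filter_upwards [hae] with x hx
      have h := hlow x
      rw [hx, Pi.zero_apply] at h
      have h1 := mul_nonneg hκ0.le (hm0 x)
      have h2 := mul_nonneg hγτ.le (hs0 x)
      have h3 : κ * (u.1 x ^ 2 * S.weight ε x t) = 0 := le_antisymm (by linarith) h1
      have h4 : γ * (t - t') ^ 2 * (η x * ‖gradient u.1 x‖ ^ 2) = 0 :=
        le_antisymm (by linarith) h2
      exact ⟨(mul_eq_zero.1 h3).resolve_left hκ0.ne', (mul_eq_zero.1 h4).resolve_left hγτ.ne'⟩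
    exact Subtype.ext (S.femSpace_eq_zero htI hK hσ hreg hδ hmesh₁ hmesh₂ hε hεδ u.2
      (hboth.mono fun _ h => h.1) (hboth.mono fun _ h => h.2))
  have hiff : ∀ u v : femSpace (S.activeCells K ε t), B u v = ℓ v ↔
      (∫ x in S.Ω, u.1 x * v.1 x * S.weight ε x t)
      - (∫ x in S.Ω, w x * v.1 x * S.weight ε x t')
      + (t - t') * (∫ x in S.Ω, inner ℝ (gradient u.1 x) (gradient v.1 x) * S.weight ε x t)
      - (t - t') * (∫ x in S.Ω, u.1 x * inner ℝ (S.velExt δ x t) (gradient v.1 x)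
          * S.weight ε x t)
      + γ * (t - t') ^ 2 * (∫ x in S.Ω, S.interp K ε t (fun y => S.phase (2 * ε) y t) x *
          inner ℝ (gradient u.1 x) (gradient v.1 x))
      = (t - t') * (∫ x in S.Ω, S.ext δ f x t * v.1 x * S.weight ε x t) := by
    intro u v
    have h1 : B u v = ∫ x in S.Ω, S.stepIntegrand K δ ε γ (t - t') t u.1 v.1 x := rfl
    have h2 : ℓ v = (∫ x in S.Ω, w x * v.1 x * S.weight ε x t')
        + (t - t') * (∫ x in S.Ω, S.ext δ f x t * v.1 x * S.weight ε x t) := by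
      have e1 : (fun x => w x * v.1 x * S.weight ε x t') =
          fun x => w x * S.weight ε x t' * v.1 x := by funext x; ring
      have e2 : (fun x => S.ext δ f x t * v.1 x * S.weight ε x t) =
          fun x => S.ext δ f x t * S.weight ε x t * v.1 x := by funext x; ring
      rw [e1, e2]
      rfl
    rw [h1, h2, S.integral_stepIntegrand hK hε u.2 v.2 ht hδ hεδ']
    constructor <;> intro h <;> linarith
  have hex := existsUnique_of_definite B hdef ℓ
  refine existsUnique_of_subtype (V := S.feSpace K ε t) ?_
  refine (existsUnique_congr fun u => ?_).1 hex
  exact ⟨fun h v hv => (hiff u ⟨v, hv⟩).1 (h ⟨v, hv⟩), fun h v => (hiff u v).2 (h v.1 v.2)⟩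

/-- Existence and uniqueness of the discrete initial function. -/
theorem existsUnique_initEq (hK : IsTriangulation S.Ω K) {u₀ : Amb n → ℝ}
    (hu₀ : IntegrableOn (fun x => S.ext δ (fun y _ => u₀ y) x 0) (S.band δ 0)) :
    ∃! u : Amb n → ℝ, u ∈ S.feSpace K ε 0 ∧ S.InitEq K δ ε u₀ u := by
  have h0 : (0 : ℝ) ∈ Icc 0 S.T := ⟨le_rfl, S.T_pos.le⟩
  set C := S.activeCells K ε 0 with hCdef
  have hfin : C.Finite := S.finite_activeCells hK
  set D := region C with hD
  have hDm : MeasurableSet D := (isCompact_region hfin).measurableSet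
  have : IsFiniteMeasure (volume.restrict D) :=
    ⟨by simpa using (isCompact_region hfin).measure_lt_top⟩
  have : FiniteDimensional ℝ (femSpace C) := femSpace.finiteDimensional hfin
  have hint : ∀ u v : femSpace C,
      Integrable (fun x => u.1 x * v.1 x) (volume.restrict D) := fun u v =>
    ((femSpace.essBdd hfin u.2 _).mul (femSpace.essBdd hfin v.2 _)).integrable
  set ℓ := integralFunctional (volume.restrict D) (femSpace C) _ fun v hv =>
    (femSpace.essBdd hfin hv _).integrable_mul (S.integrable_ext h0 hu₀).restrict with hℓ
  set B : femSpace C →ₗ[ℝ] femSpace C →ₗ[ℝ] ℝ := integralForm (volume.restrict D)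
    (fun u v x => u.1 x * v.1 x) hint
    (fun u u' v => Eventually.of_forall fun x => by simp [add_mul])
    (fun c u v => Eventually.of_forall fun x => by simp [mul_assoc])
    (fun u v v' => Eventually.of_forall fun x => by simp [mul_add])
    (fun c u v => Eventually.of_forall fun x => by simp; ring) with hB
  have hdef : ∀ u, B u u = 0 → u = 0 := by
    intro u hBu
    have hae : (fun x => u.1 x * u.1 x) =ᵐ[volume.restrict D] 0 :=
      (integral_eq_zero_iff_of_nonneg (fun x => mul_self_nonneg _) (hint u u)).1 hBu
    refine Subtype.ext (femSpace.ext_vertices u.2 (femSpace C).zero_mem fun s hs x hx => ?_)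
    have hsub := simplex_subset_region hs
    -- If u ≠ 0 at a vertex, continuity gives u ≠ 0 on a nonempty open part of the interior of the
    -- cell, against u² = 0 almost everywhere.
    by_contra hne
    have hcont : ContinuousWithinAt u.1 (simplex s) x :=
      (u.2.1.mono hsub) x (mem_simplex_of_mem hx)
    obtain ⟨U, hU, hxU, hUs⟩ := mem_nhdsWithin.1
      (hcont.eventually (isOpen_ne.eventually_mem (show u.1 x ≠ 0 from hne)))
    obtain ⟨z, hzU, hz⟩ := mem_closure_iff.1
      (simplex_subset_closure_interior hs.1 (mem_simplex_of_mem hx)) U hU hxU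
    obtain ⟨y, hy, hy0⟩ := exists_mem_of_ae_restrict hae (isOpen_interior.inter hU)
      ⟨z, hz, hzU⟩ (inter_subset_left.trans (interior_subset.trans hsub))
    exact hUs ⟨hy.2, interior_subset hy.1⟩ (mul_self_eq_zero.1 hy0)
  refine existsUnique_of_subtype (V := S.feSpace K ε 0) ?_
  refine (existsUnique_congr fun u => ?_).1 (existsUnique_of_definite B hdef ℓ)
  exact ⟨fun h v hv => h ⟨v, hv⟩, fun h v => h v.1 v.2⟩

end MovingSurface

/-- A recursion with unique initial value and unique successors has a unique solution. -/
lemma existsUnique_fin_recursion {X : Type*} {M : ℕ} {p : Fin (M + 1) → X → Prop} {p₀ : X → Prop}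
    {R : Fin M → X → X → Prop} (h₀ : ∃! x, p 0 x ∧ p₀ x)
    (hR : ∀ m : Fin M, ∀ w, p m.castSucc w → ∃! u, p m.succ u ∧ R m w u) :
    ∃! u : Fin (M + 1) → X, (∀ m, p m (u m)) ∧ p₀ (u 0) ∧
      ∀ m : Fin M, R m (u m.castSucc) (u m.succ) := by
  classical
  obtain ⟨x₀, hx₀, hx₀u⟩ := h₀
  choose next hnext hnextu using fun (m : Fin M) (w : {w // p m.castSucc w}) => hR m w.1 w.2
  let seq : (m : Fin (M + 1)) → {x // p m x} := fun m =>
    Fin.induction (motive := fun m => {x // p m x}) ⟨x₀, hx₀.1⟩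
      (fun m w => ⟨next m w, (hnext m w).1⟩) m
  have hseq0 : (seq 0).1 = x₀ := rfl
  have hseqS : ∀ m : Fin M, (seq m.succ).1 = next m (seq m.castSucc) := fun m => by
    simp only [seq, Fin.induction_succ]
  refine ⟨fun m => (seq m).1, ⟨fun m => (seq m).2, by simpa only [hseq0] using hx₀.2,
    fun m => ?_⟩, ?_⟩
  · simp only [hseqS]
    exact (hnext m _).2
  · rintro u ⟨hup, hu0, huR⟩
    funext m
    induction m using Fin.induction with
    | zero => exact hx₀u (u 0) ⟨hup 0, hu0⟩
    | succ m ih =>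
      have h := hnextu m (seq m.castSucc) (u m.succ)
      refine (h ⟨hup _, ?_⟩).trans (hseqS m).symm
      have := huR m
      rwa [ih] at this

/-! ### Time partitions and the full scheme -/

section Partition

variable {T : ℝ} (P : TimePartition T)

lemma TimePartition.mem_Icc (m : Fin (P.M + 1)) : P.t m ∈ Icc 0 T :=
  ⟨P.first.symm.trans_le (P.strictMono.monotone (Fin.zero_le m)),
    (P.strictMono.monotone (Fin.le_last m)).trans_eq P.last⟩

lemma TimePartition.lt_succ (m : Fin P.M) : P.t m.castSucc < P.t m.succ :=
  P.strictMono Fin.castSucc_lt_succ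

lemma TimePartition.succ_mem_Ioc (m : Fin P.M) : P.t m.succ ∈ Ioc 0 T :=
  ⟨(P.mem_Icc m.castSucc).1.trans_lt (P.lt_succ m), (P.mem_Icc m.succ).2⟩

lemma TimePartition.step_le_maxStep (m : Fin P.M) :
    P.t m.succ - P.t m.castSucc ≤ P.maxStep :=
  le_ciSup (f := fun m : Fin P.M => P.t m.succ - P.t m.castSucc) (finite_range _).bddAbove m

end Partition

theorem lemma5 {n : ℕ} (hn : n = 1 ∨ n = 2) (S : MovingSurface n)
    (δ : ℝ) (hδ : 0 < δ) (hδ₀ : δ < S.δ₀) (h₀ σ : ℝ) (hh₀ : 0 < h₀) (hσ : 0 < σ) :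
    ∃ h₁ : ℝ, 0 < h₁ ∧ h₁ ≤ h₀ ∧ ∀ h : ℝ, 0 < h → h ≤ h₁ →
      ∃ τ₀ : ℝ, 0 < τ₀ ∧
        ∀ K : Geometry.SimplicialComplex ℝ (Amb n),
          IsTriangulation S.Ω K → meshSize K = h → IsShapeRegular σ K →
        ∀ ε : ℝ, 0 < ε → ε < δ / Real.pi → ∀ γ : ℝ, 0 < γ →
        ∀ P : TimePartition S.T, P.maxStep ≤ τ₀ →
        ∀ f : Amb n → ℝ → ℝ,
          (∀ m : Fin P.M, IntegrableOn (fun x => S.ext δ f x (P.t m.succ))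
            (S.band δ (P.t m.succ))) →
          (∀ m : Fin P.M, ∀ w ∈ S.feSpace K ε (P.t m.castSucc),
            ∃! u : Amb n → ℝ, u ∈ S.feSpace K ε (P.t m.succ) ∧
              S.StepEq K δ ε γ f (P.t m.castSucc) (P.t m.succ) w u) ∧
          ∀ u₀ : Amb n → ℝ,
            IntegrableOn (fun x => S.ext δ (fun y _ => u₀ y) x 0) (S.band δ 0) →
            ∃! u : Fin (P.M + 1) → Amb n → ℝ, S.IsDiscreteSolution K δ ε γ P u₀ f u := by
  have hc₀ := S.c₀_pos
  have hc₁ : 0 < S.c₁ := hc₀.trans_le S.c₀_le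
  have hc₂ := S.c₂_pos
  obtain ⟨C, -, hC⟩ := S.exists_bound_velExt hδ₀
  -- For h ≤ a, balls of radius h around points of U_δ stay in U_{δ₀}. The extra factor 2 in the
  -- denominator of b makes the descent condition strict.
  set a := (S.δ₀ - δ) / S.c₁ with ha
  set b := S.c₀ * (σ / (4 * (n + 2))) / (2 * S.c₂) with hb
  have ha0 : 0 < a := div_pos (sub_pos.2 hδ₀) hc₁
  have hb0 : 0 < b := by positivity
  -- This τ₀ does not depend on h; it even gives τ_m C² < 1, and the added 1 covers C = 0.
  refine ⟨min h₀ (min a b), lt_min hh₀ (lt_min ha0 hb0), min_le_left _ _, fun h hh hle =>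
    ⟨1 / (C ^ 2 + 1), by positivity, ?_⟩⟩
  intro K hK hmesh hreg ε hε hεδ γ hγ P hP f hf
  have hεδ' : ε * Real.pi < δ := (lt_div_iff₀ Real.pi_pos).1 hεδ
  have hmesh₁ : δ + S.c₁ * meshSize K ≤ S.δ₀ := by
    have : h ≤ a := hle.trans ((min_le_right _ _).trans (min_le_left _ _))
    rw [ha, le_div_iff₀ hc₁] at this
    rw [hmesh]
    linarith
  have hmesh₂ : S.c₂ * meshSize K < S.c₀ * (σ / (4 * (n + 2))) := by
    have h1 : h ≤ b := hle.trans ((min_le_right _ _).trans (min_le_right _ _))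
    rw [hb, le_div_iff₀ (by positivity)] at h1
    rw [hmesh]
    nlinarith [mul_pos hh hc₂]
  have hstep : ∀ m : Fin P.M, ∀ w ∈ S.feSpace K ε (P.t m.castSucc),
      ∃! u : Amb n → ℝ, u ∈ S.feSpace K ε (P.t m.succ) ∧
        S.StepEq K δ ε γ f (P.t m.castSucc) (P.t m.succ) w u := by
    intro m w hw
    have hτ : (P.t m.succ - P.t m.castSucc) * C ^ 2 < 4 := by
      have h1 := (P.step_le_maxStep m).trans hP
      rw [le_div_iff₀ (by positivity)] at h1
      nlinarith [P.lt_succ m]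
    exact S.existsUnique_stepEq hK hσ hreg hδ₀ hmesh₁ hmesh₂ hε hεδ' hγ (P.mem_Icc _)
      (P.succ_mem_Ioc m) (P.lt_succ m) (hC _ (P.succ_mem_Ioc m)) hτ (hf m) hw
  refine ⟨hstep, fun u₀ hu₀ => ?_⟩
  refine existsUnique_fin_recursion (p := fun m u => u ∈ S.feSpace K ε (P.t m)) ?_ hstep
  rw [P.first]
  exact S.existsUnique_initEq hK hu₀
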